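/- Let $\mathbb D=\{z\in\mathbb C:|z|<1\}$. For functions $F,G$ analytic on $\mathbb D$, write $F\prec G$ if there is an analytic $w$ on $\mathbb D$ with $w(0)=0$, $|w(z)|<1$ and $F(z)=G(w(z))$ for all $z\in\mathbb D$. Let $\mathcal A$ be the class of functions $f$ analytic on $\mathbb D$ with $f(0)=0$ and $f'(0)=1$, and put $$\mathfrak M(z)=1-\frac{zf'(z)}{f(z)}+\frac{zf''(z)}{f'(z)},\qquad \phi_c(z)=1+\frac{4z}{3}+\frac{2z^2}{3},\qquad \mathcal Q(z)=e^{e^z-1}.$$ Let $\mathcal S^*_B$ be the class of all $f\in\mathcal A$ with $\dfrac{zf'(z)}{f(z)}\prec\mathcal Q(z)$. The quotients here are meromorphic functions on $\mathbb D$, extended by their limits at removable singularities (in particular at $z=0$); a subordination $F\prec G$ includes the assertion that $F$, so extended, is analytic on $\mathbb D$. Let $f\in\mathcal A$ and $\beta\in\mathbb R$. If at least one of the following holds: (a) $1+\beta\,\dfrac{zf'(z)}{f(z)}\,\mathfrak M(z)\prec\phi_c(z)$ and $\beta\ge\dfrac{1}{1-e^{e^{-1}-1}}$; (b) $1+\beta\,\mathfrak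 M(z)\prec\phi_c(z)$ and $\beta\ge\dfrac{e}{e-1}$; (c) $1+\beta\left(\dfrac{zf'(z)}{f(z)}\right)^{-1}\mathfrak M(z)\prec\phi_c(z)$ and $\beta\ge\dfrac{5e^{e-1}}{3(e^{e-1}-1)}$; then $f\in\mathcal S^*_B$. -/

import Mathlib

/-- The open unit disc `{z : |z| < 1}` of the complex plane. -/
def unitDisc : Set ℂ := Metric.ball 0 1

/-- The class `𝒜` of functions analytic on the open unit disc with `f(0) = 0` and `f'(0) = 1`
(only the values of `f` on the disc matter). -/
def classA : Set (ℂ → ℂ) :=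
  {f | AnalyticOnNhd ℂ f unitDisc ∧ f 0 = 0 ∧ deriv f 0 = 1}

/-- `F ≺ G`: both functions are analytic on the open unit disc and `F(z) = G(w(z))` there, for some
analytic `w` on the disc with `w(0) = 0` and `|w(z)| < 1`. -/
def Subordinate (F G : ℂ → ℂ) : Prop :=
  AnalyticOnNhd ℂ F unitDisc ∧ AnalyticOnNhd ℂ G unitDisc ∧
    ∃ w : ℂ → ℂ, AnalyticOnNhd ℂ w unitDisc ∧ w 0 = 0 ∧ (∀ z ∈ unitDisc, ‖w z‖ < 1) ∧
      ∀ z ∈ unitDisc, F z = G (w z)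

/-- A function given on the unit disc by a quotient formula, read as a meromorphic function: at a
removable singularity (such as `z = 0` for `z f'(z) / f(z)`) its value is the limit there. At a pole
the value is `0`, so that a function with a pole is not analytic on the disc. -/
noncomputable def removeSing (F : ℂ → ℂ) : ℂ → ℂ := toMeromorphicNFOn F unitDisc

/-- `z f'(z) / f(z)`. -/
noncomputable def starQuot (f : ℂ → ℂ) (z : ℂ) : ℂ := z * deriv f z / f z

/-- `𝔐(z) = 1 - z f'(z) / f(z) + z f''(z) / f'(z)`. -/
noncomputable def frakM (f : ℂ → ℂ) (z : ℂ) : ℂ :=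
  1 - z * deriv f z / f z + z * deriv (deriv f) z / deriv f z

/-- The class `𝒮*_φ` of all `f ∈ 𝒜` with `z f'(z) / f(z) ≺ φ(z)`. -/
def starlikeClass (φ : ℂ → ℂ) : Set (ℂ → ℂ) :=
  {f | f ∈ classA ∧ Subordinate (removeSing (starQuot f)) φ}

/-- `𝒬(z) = exp (exp z - 1)`. -/
noncomputable def bellQ (z : ℂ) : ℂ := Complex.exp (Complex.exp z - 1)

/-- `φ_c(z) = 1 + 4z/3 + 2z²/3`. -/
noncomputable def phiC (z : ℂ) : ℂ := 1 + 4 * z / 3 + 2 * z ^ 2 / 3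

/-- The class `𝒮*_B = 𝒮*_𝒬`. -/
def starlikeB : Set (ℂ → ℂ) := starlikeClass bellQ

/-! Write p = zf'/f. Logarithmic differentiation gives 𝔐 = zp'/p, so the three hypotheses all read 1
+ βzR' ≺ φ_c, with R = p - 1, log p and 1 - 1/p respectively. Since φ_c(z) - 1 = zq'(z) for q(ω) =
(4ω + ω²)/3, the natural conclusion is that R takes values in b·q(𝔻) whenever β ≥ 1/b.

That conclusion is `mem_limaconDomain`. If R/b left the limaçon domain q(𝔻), then at a first exit
point, where q⁻¹ ∘ (R/b) equals some ζ with |ζ| = 1, Jack's lemma (`jack`) would give z(R/b)' =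
kζq'(ζ) with k ≥ 1. The hypothesis puts z(R/b)' in a shrunken copy of the cardioid domain {ωq'(ω) :
|ω| < 1}, and this domain is starlike (`cardioid_starlike`), a contradiction.

It remains to write p = 𝒬(W) with W given by explicit logarithms and W(0) = 0. As the disc is
connected, |W| < 1 follows once |W| ≠ 1, that is, once the relevant image of the unit circle misses
the relevant limaçon domain. The bounds on β are those for which the two curves touch: at w = ω = -1
in (a) and (b), at w = ω = 1 in (c). In (a) and (b) this rests on an implicit inequality for the
limaçon (`not_limacon_exterior`) combined with `bell_circle_exterior` and `exp_circle_exterior`; in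
(c) the disc of radius 5/3 around the limaçon is enough, and `one_sub_exp_circle_ge` supplies the
estimate.

A priori f may have zeros in the punctured disc, so R is only used near 0. The subordination
provides a continuation of it to the whole disc, and the identity theorem carries the result back to
f. -/

/-! ### Taylor bounds for the real exponential, sine and cosine. -/

theorem nonneg_of_hasDerivAt_nonneg {f f' : ℝ → ℝ} (h0 : 0 ≤ f 0)
    (hf : ∀ x, HasDerivAt f (f' x) x) (hf' : ∀ x, 0 < x → 0 ≤ f' x) {x : ℝ} (hx : 0 ≤ x) :
    0 ≤ f x := by
  have hm : MonotoneOn f (Set.Ici 0) := by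
    apply monotoneOn_of_deriv_nonneg (convex_Ici 0)
    · exact fun y _ => (hf y).continuousAt.continuousWithinAt
    · exact fun y _ => (hf y).differentiableAt.differentiableWithinAt
    · intro y hy
      rw [interior_Ici] at hy
      rw [(hf y).deriv]
      exact hf' y hy
  exact h0.trans (hm Set.self_mem_Ici hx hx)

theorem cos_le_one_sub_sq_add_pow_four (x : ℝ) : Real.cos x ≤ 1 - x ^ 2 / 2 + x ^ 4 / 24 := by
  have key : ∀ y : ℝ, 0 ≤ y → Real.cos y ≤ 1 - y ^ 2 / 2 + y ^ 4 / 24 := by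
    intro y hy
    have := nonneg_of_hasDerivAt_nonneg (f := fun x => 1 - x ^ 2 / 2 + x ^ 4 / 24 - Real.cos x)
      (f' := fun x => - x + x ^ 3 / 6 + Real.sin x) (by simp) (fun x => by
        have h := ((((hasDerivAt_pow 2 x).div_const 2).const_sub 1).add
          ((hasDerivAt_pow 4 x).div_const 24)).sub (Real.hasDerivAt_cos x)
        exact h.congr_deriv (by push_cast; ring)) (fun x hx => by linarith [Real.sin_ge_sub_cube hx.le]) hy
    linarith
  have h := key |x| (abs_nonneg x)
  have h4 : |x| ^ 4 = x ^ 4 := Even.pow_abs (by decide) x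
  rwa [Real.cos_abs, sq_abs, h4] at h

theorem sin_sq_ge {s : ℝ} (hs : s ^ 2 ≤ 6) : s ^ 2 * (1 - s ^ 2 / 3) ≤ Real.sin s ^ 2 := by
  have key : ∀ y : ℝ, 0 ≤ y → y ^ 2 ≤ 6 → y ^ 2 * (1 - y ^ 2 / 3) ≤ Real.sin y ^ 2 := by
    intro y hy hy6
    have h1 := Real.sin_ge_sub_cube hy
    have h2 : 0 ≤ y - y ^ 3 / 6 := by nlinarith
    nlinarith [pow_le_pow_left₀ h2 h1 2, sq_nonneg (y ^ 3)]
  rcases abs_cases s with ⟨h, _⟩ | ⟨h, _⟩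
  · exact key s (by linarith) hs
  · simpa using key (-s) (by linarith) (by simpa using hs)

theorem hasDerivAt_exp_neg (x : ℝ) : HasDerivAt (fun x : ℝ => Real.exp (-x)) (-Real.exp (-x)) x := by
  simpa using (hasDerivAt_neg x).exp

theorem exp_neg_le_quadratic {u : ℝ} (hu : 0 ≤ u) : Real.exp (-u) ≤ 1 - u + u ^ 2 / 2 := by
  have := nonneg_of_hasDerivAt_nonneg (f := fun x => 1 - x + x ^ 2 / 2 - Real.exp (-x))
    (f' := fun x => - 1 + x + Real.exp (-x)) (by simp) (fun x => by
      have h := (((hasDerivAt_id x).const_sub 1).add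
          ((hasDerivAt_pow 2 x).div_const 2)).sub (hasDerivAt_exp_neg x)
      exact h.congr_deriv (by push_cast; ring)) (fun x _ => by linarith [Real.add_one_le_exp (-x)]) hu
  linarith

theorem cubic_le_exp_neg {u : ℝ} (hu : 0 ≤ u) :
    1 - u + u ^ 2 / 2 - u ^ 3 / 6 ≤ Real.exp (-u) := by
  have := nonneg_of_hasDerivAt_nonneg
    (f := fun x => Real.exp (-x) - (1 - x + x ^ 2 / 2 - x ^ 3 / 6))
    (f' := fun x => 1 - x + x ^ 2 / 2 - Real.exp (-x)) (by simp) (fun x => by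
      have h := (hasDerivAt_exp_neg x).sub ((((hasDerivAt_id x).const_sub 1).add
          ((hasDerivAt_pow 2 x).div_const 2)).sub ((hasDerivAt_pow 3 x).div_const 6))
      exact h.congr_deriv (by push_cast; ring)) (fun x hx => by linarith [exp_neg_le_quadratic hx.le]) hu
  linarith

theorem exp_neg_le_quartic {u : ℝ} (hu : 0 ≤ u) :
    Real.exp (-u) ≤ 1 - u + u ^ 2 / 2 - u ^ 3 / 6 + u ^ 4 / 24 := by
  have := nonneg_of_hasDerivAt_nonneg
    (f := fun x => 1 - x + x ^ 2 / 2 - x ^ 3 / 6 + x ^ 4 / 24 - Real.exp (-x))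
    (f' := fun x => Real.exp (-x) - (1 - x + x ^ 2 / 2 - x ^ 3 / 6)) (by simp) (fun x => by
      have h := (((((hasDerivAt_id x).const_sub 1).add
          ((hasDerivAt_pow 2 x).div_const 2)).sub ((hasDerivAt_pow 3 x).div_const 6)).add
          ((hasDerivAt_pow 4 x).div_const 24)).sub (hasDerivAt_exp_neg x)
      exact h.congr_deriv (by push_cast; ring)) (fun x hx => by linarith [cubic_le_exp_neg hx.le]) hu
  linarith

theorem quintic_le_exp_neg {u : ℝ} (hu : 0 ≤ u) :
    1 - u + u ^ 2 / 2 - u ^ 3 / 6 + u ^ 4 / 24 - u ^ 5 / 120 ≤ Real.exp (-u) := by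
  have := nonneg_of_hasDerivAt_nonneg
    (f := fun x => Real.exp (-x) - (1 - x + x ^ 2 / 2 - x ^ 3 / 6 + x ^ 4 / 24 - x ^ 5 / 120))
    (f' := fun x => 1 - x + x ^ 2 / 2 - x ^ 3 / 6 + x ^ 4 / 24 - Real.exp (-x)) (by simp)
    (fun x => by
      have h := (hasDerivAt_exp_neg x).sub ((((((hasDerivAt_id x).const_sub 1).add
          ((hasDerivAt_pow 2 x).div_const 2)).sub ((hasDerivAt_pow 3 x).div_const 6)).add
          ((hasDerivAt_pow 4 x).div_const 24)).sub ((hasDerivAt_pow 5 x).div_const 120))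
      exact h.congr_deriv (by push_cast; ring)) (fun x hx => by linarith [exp_neg_le_quartic hx.le]) hu
  linarith

/-! ### Real estimates on the images of the unit circle. -/

/-- The unit circle is parametrised as w = (u - 1) + is, with u = 0 at the touching point w = -1. On
it 1 - s²/2 is exactly the quadratic 1 - u + u²/2, which dominates exp(-u). -/
theorem one_le_exp_mul_cos {u s : ℝ} (hu : 0 ≤ u) (hs : s ^ 2 = u * (2 - u)) :
    1 ≤ Real.exp u * Real.cos s := by
  have h1 := exp_neg_le_quadratic hu
  have h2 := Real.one_sub_sq_div_two_le_cos (x := s)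
  have h3 : Real.exp u * Real.exp (-u) = 1 := by rw [← Real.exp_add]; simp
  rw [← h3]
  gcongr
  nlinarith

/-- The Taylor polynomials of cos s and exp(-u) agree to first order in u, so the excess is only of
order u²; this is what makes the contact at w = -1 tractable. -/
theorem exp_mul_cos_le {u s : ℝ} (hu : 0 ≤ u) (hs : s ^ 2 = u * (2 - u)) :
    Real.exp u * Real.cos s ≤ 1 + Real.exp u * (u ^ 2 * (1 / 6 + u ^ 3 / 120)) := by
  have h1 := quintic_le_exp_neg hu
  have h2 := cos_le_one_sub_sq_add_pow_four s
  have h3 : Real.exp u * Real.exp (-u) = 1 := by rw [← Real.exp_add]; simp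
  rw [show s ^ 4 = (s ^ 2) ^ 2 by ring, hs] at h2
  have h4 : Real.cos s ≤ Real.exp (-u) + u ^ 2 * (1 / 6 + u ^ 3 / 120) := by linarith
  have h5 := mul_le_mul_of_nonneg_left h4 (Real.exp_pos u).le
  linarith

theorem cubic_le_exp {u : ℝ} (hu : 0 ≤ u) : 1 + u + u ^ 2 / 2 + u ^ 3 / 6 ≤ Real.exp u := by
  have := Real.sum_le_exp_of_nonneg hu 4
  simpa [Finset.sum_range_succ, Nat.factorial] using this

theorem quintic_le_exp {u : ℝ} (hu : 0 ≤ u) :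
    1 + u + u ^ 2 / 2 + u ^ 3 / 6 + u ^ 4 / 24 + u ^ 5 / 120 ≤ Real.exp u := by
  have := Real.sum_le_exp_of_nonneg hu 6
  simpa [Finset.sum_range_succ, Nat.factorial] using this

/-- The image of the unit circle under `exp`, rescaled so that `e⁻¹` goes to `-1`, satisfies the
inequality describing the exterior of the limaçon `{(4ω + ω²)/3 : |ω| < 1}`. -/
theorem exp_circle_exterior {u s : ℝ} (hu : 0 ≤ u) (hu2 : u ≤ 2) (hs : s ^ 2 = u * (2 - u)) :
    let x := Real.exp u * Real.cos s - 1
    let N := Real.exp u ^ 2 - 1 - 2 * Real.exp 1 * x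
    0 ≤ N ∧ 32 * (Real.exp 1 - 1) ^ 3 * x ≤ 27 * N ^ 2 := by
  intro x N
  have e1 := Real.exp_one_gt_d9
  have e2 := Real.exp_one_lt_d9
  have hx0 : 0 ≤ x := by have := one_le_exp_mul_cos hu hs; simp only [x]; linarith
  have hx1 : x ≤ Real.exp u * (u ^ 2 * (1 / 6 + u ^ 3 / 120)) := by
    have := exp_mul_cos_le hu hs; simp only [x]; linarith
  set E := Real.exp u with hE
  have hE1 : 1 ≤ E := Real.one_le_exp hu
  have hEE : E * Real.exp (-u) = 1 := by rw [hE, ← Real.exp_add]; simp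
  have hq := quintic_le_exp hu
  have hn := exp_neg_le_quartic hu
  have hsinh : 2 * u + u ^ 3 / 3 ≤ E - Real.exp (-u) - u ^ 5 / 120 := by linarith
  have hk : 0 ≤ 1.05 - 0.2 * u := by linarith
  -- Near u = 0, N has order u and x has order u², so both sides of the goal have order u². A linear
  -- factor that stays positive up to u = 2 leaves enough room.
  have hN : (1.05 - 0.2 * u) * u * E ≤ N := by
    have h1 : N = E * (E - Real.exp (-u)) - 2 * Real.exp 1 * x := by
      simp only [N]; linarith [hEE]
    have h2 : 2 * Real.exp 1 * x ≤ 2 * 2.7182818286 * (E * (u ^ 2 * (1 / 6 + u ^ 3 / 120))) := by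
      gcongr
    have h3 : (1.05 - 0.2 * u) * u + 2 * 2.7182818286 * (u ^ 2 * (1 / 6 + u ^ 3 / 120)) ≤
        E - Real.exp (-u) := by
      have h4 : 0 ≤ 0.9 - 0.71 * u + u ^ 2 / 3 - 0.04 * u ^ 4 := by
        nlinarith [sq_nonneg (u - 1.4), mul_nonneg hu (sub_nonneg.2 hu2),
          mul_nonneg (sq_nonneg u) (sub_nonneg.2 hu2), mul_nonneg (pow_nonneg hu 3) (sub_nonneg.2 hu2)]
      nlinarith [mul_nonneg hu h4, pow_nonneg hu 3, pow_nonneg hu 5]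
    rw [h1]
    nlinarith [mul_le_mul_of_nonneg_left h3 (zero_le_one.trans hE1)]
  have hN0 : 0 ≤ N := le_trans (by positivity) hN
  refine ⟨hN0, ?_⟩
  have h5 : (Real.exp 1 - 1) ^ 3 ≤ 5.08 := by
    have : (Real.exp 1 - 1) ^ 3 ≤ (1.7182818286 : ℝ) ^ 3 := by
      apply pow_le_pow_left₀ <;> linarith
    exact this.trans (by norm_num)
  have h6 : 1.01 * (1 + u ^ 3 / 20) ≤ (1.05 - 0.2 * u) ^ 2 * E := by
    have h7 : 1 + u + u ^ 2 / 2 ≤ E := Real.quadratic_le_exp_of_nonneg hu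
    refine le_trans ?_ (mul_le_mul_of_nonneg_left h7 (sq_nonneg _))
    nlinarith [mul_nonneg hu (sub_nonneg.2 hu2),
      mul_nonneg (sq_nonneg u) (sub_nonneg.2 hu2), pow_nonneg hu 4]
  calc 32 * (Real.exp 1 - 1) ^ 3 * x
      ≤ 32 * 5.08 * (E * (u ^ 2 * (1 / 6 + u ^ 3 / 120))) := by gcongr
    _ = 27 * (E * u ^ 2) * (32 * 5.08 / (27 * 6) * (1 + u ^ 3 / 20)) := by ring
    _ ≤ 27 * (E * u ^ 2) * ((1.05 - 0.2 * u) ^ 2 * E) := by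
        refine mul_le_mul_of_nonneg_left (le_trans ?_ h6) (by positivity)
        exact mul_le_mul_of_nonneg_right (by norm_num) (by positivity)
    _ = 27 * ((1.05 - 0.2 * u) * u * E) ^ 2 := by ring
    _ ≤ 27 * N ^ 2 := by gcongr

theorem exp_neg_one_bounds : 0.36787 < Real.exp (-1) ∧ Real.exp (-1) < 0.36788 := by
  have e1 := Real.exp_one_gt_d9
  have e2 := Real.exp_one_lt_d9
  have h : Real.exp 1 * Real.exp (-1) = 1 := by rw [← Real.exp_add]; simp
  have := Real.exp_pos (-1)
  constructor <;> nlinarith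

theorem exp_one_sub_exp_neg_one_lt : Real.exp (1 - Real.exp (-1)) < 1.882 := by
  have h1 : Real.exp (1 - Real.exp (-1)) ≤ Real.exp 0.63213 :=
    Real.exp_le_exp.2 (by linarith [exp_neg_one_bounds.1])
  have h2 := Real.exp_bound' (x := 0.63213) (by norm_num) (by norm_num) (n := 7) (by norm_num)
  refine (h1.trans h2).trans_lt ?_
  norm_num [Finset.sum_range_succ, Nat.factorial]

theorem cos_le_exp_neg_sq_div_two {y : ℝ} (hy : y ^ 2 ≤ 4) :
    Real.cos y ≤ Real.exp (-(y ^ 2 / 2)) := by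
  have h1 := cos_le_one_sub_sq_add_pow_four y
  have h2 := cubic_le_exp_neg (u := y ^ 2 / 2) (by positivity)
  nlinarith [mul_nonneg (sq_nonneg (y ^ 2)) (sub_nonneg.2 hy)]

/-- The image of the unit circle under `exp (exp z - 1)`, rescaled so that `exp (e⁻¹ - 1)` goes to
`-1`, satisfies the inequality describing the exterior of the limaçon
`{(4ω + ω²)/3 : |ω| < 1}`. -/
theorem bell_circle_exterior {u s : ℝ} (hu : 0 ≤ u) (hu2 : u ≤ 2) (hs : s ^ 2 = u * (2 - u)) :
    let x := Real.exp u * Real.cos s - 1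
    let y := Real.exp u * Real.sin s
    let κ := Real.exp (1 - Real.exp (-1))
    let E := Real.exp (Real.exp (-1) * x)
    let X := E * Real.cos (Real.exp (-1) * y) - 1
    let N := E ^ 2 - 1 - 2 * κ * X
    0 ≤ N ∧ 32 * (κ - 1) ^ 3 * X ≤ 27 * N ^ 2 := by
  intro x y κ E X N
  obtain ⟨i1, i2⟩ := exp_neg_one_bounds
  have hκ2 : κ < 1.882 := exp_one_sub_exp_neg_one_lt
  have hκ1 : 1 ≤ κ := Real.one_le_exp (by linarith)
  have hx0 : 0 ≤ x := by have := one_le_exp_mul_cos hu hs; simp only [x]; linarith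
  have hE1 : 1 ≤ E := Real.one_le_exp (by positivity)
  have hs1 : s ^ 2 ≤ 1 := by rw [hs]; nlinarith [sq_nonneg (u - 1)]
  have hsin := sin_sq_ge (s := s) (by linarith)
  have hsin' : Real.sin s ^ 2 ≤ s ^ 2 := by
    rw [sq_le_sq]; exact Real.abs_sin_le_abs
  have hY : (Real.exp (-1) * y) ^ 2 = Real.exp (-1) ^ 2 * Real.exp u ^ 2 * Real.sin s ^ 2 := by
    simp only [y]; ring
  have hκ3 : (κ - 1) ^ 3 ≤ 0.687 := by
    have : (κ - 1) ^ 3 ≤ 0.882 ^ 3 := by apply pow_le_pow_left₀ <;> linarith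
    exact this.trans (by norm_num)
  have hκ0 : 0 ≤ (κ - 1) ^ 3 := pow_nonneg (by linarith) 3
  -- When X ≤ 0, both terms E² - 1 and -2κX are nonnegative, and the second inequality has a
  -- nonpositive left side.
  have hneg : X ≤ 0 → 0 ≤ N ∧ 32 * (κ - 1) ^ 3 * X ≤ 27 * N ^ 2 := by
    intro h
    constructor
    · simp only [N]; nlinarith
    · nlinarith [sq_nonneg N]
  rcases le_total X 0 with hX | hX
  · exact hneg hX
  have hNX : E ^ 2 - 1 - 3.764 * X ≤ N := by simp only [N]; nlinarith
  have hRX : 32 * (κ - 1) ^ 3 * X ≤ 27 * (0.8145 * X) := by nlinarith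
  -- Here 3.764 = 2 · 1.882 bounds 2κ, and 0.8145 is a rounding up of 32 · 0.687 / 27.
  suffices h : 0 ≤ E ^ 2 - 1 - 3.764 * X ∧ 0.8145 * X ≤ (E ^ 2 - 1 - 3.764 * X) ^ 2 by
    refine ⟨h.1.trans hNX, hRX.trans ?_⟩
    have := pow_le_pow_left₀ h.1 hNX 2
    linarith [h.2]
  clear_value κ
  -- With Y = y/e, the range u ≤ 1.3 satisfies x/e ≤ Y²/2, and cos Y ≤ exp(-Y²/2) then forces X ≤ 0.
  -- This absorbs the touching point.
  rcases le_total u 1.3 with h13 | h13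
  · have hx1 : x ≤ Real.exp u * (u ^ 2 * (1 / 6 + u ^ 3 / 120)) := by
      have := exp_mul_cos_le hu hs; simp only [x]; linarith
    have hexpu : Real.exp u ≤ 3.8 := by
      refine (Real.exp_le_exp.2 h13).trans ?_
      have h1 := Real.exp_bound' (x := 0.3) (by norm_num) (by norm_num) (n := 4) (by norm_num)
      rw [show (1.3 : ℝ) = 1 + 0.3 by norm_num, Real.exp_add]
      calc _ ≤ (2.7182818286 : ℝ) * _ := mul_le_mul Real.exp_one_lt_d9.le h1
            (Real.exp_pos _).le (by norm_num)
        _ ≤ 3.8 := by norm_num [Finset.sum_range_succ, Nat.factorial]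
    have hY4 : (Real.exp (-1) * y) ^ 2 ≤ 4 := by
      rw [hY]
      calc _ ≤ (0.36788 : ℝ) ^ 2 * 3.8 ^ 2 * 1 := by gcongr; linarith
        _ ≤ 4 := by norm_num
    have hcos := cos_le_exp_neg_sq_div_two hY4
    have hpoly : u * (1 / 6 + u ^ 3 / 120) ≤
        (1 + u + u ^ 2 / 2) * ((2 - u) * (1 - u * (2 - u) / 3)) * (0.36787 / 2) := by
      have h1 : u ^ 3 ≤ 1.3 ^ 3 := by gcongr
      have h2 : u * (1 / 6 + u ^ 3 / 120) ≤ 1.3 * (1 / 6 + 1.3 ^ 3 / 120) := by gcongr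
      have h3 : 2 ≤ (1 + u + u ^ 2 / 2) * (2 - u) := by
        have : 0 ≤ u * (2 - u ^ 2) := mul_nonneg hu (by nlinarith only [hu, h13])
        linarith
      have h4 : 2 / 3 ≤ 1 - u * (2 - u) / 3 := by linarith [sq_nonneg (u - 1)]
      have h5 := mul_le_mul h3 h4 (by norm_num) (by linarith)
      norm_num at h2 ⊢
      linarith
    have hxy : Real.exp (-1) * x ≤ (Real.exp (-1) * y) ^ 2 / 2 := by
      rw [hY]
      have hpos : 0 ≤ (2 - u) * (1 - u * (2 - u) / 3) := by
        exact mul_nonneg (by linarith) (by linarith [sq_nonneg (u - 1)])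
      have h1 : u * (1 / 6 + u ^ 3 / 120) ≤
          Real.exp u * ((2 - u) * (1 - u * (2 - u) / 3)) * (Real.exp (-1) / 2) := by
        refine hpoly.trans ?_
        gcongr
        exact Real.quadratic_le_exp_of_nonneg hu
      have h2 : x ≤ Real.exp u ^ 2 * (s ^ 2 * (1 - s ^ 2 / 3)) * (Real.exp (-1) / 2) := by
        rw [hs]
        have := mul_le_mul_of_nonneg_left h1 (mul_nonneg (Real.exp_pos u).le hu)
        linarith
      have h3 : x ≤ Real.exp u ^ 2 * (Real.sin s ^ 2) * (Real.exp (-1) / 2) :=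
        h2.trans (by gcongr)
      have := mul_le_mul_of_nonneg_left h3 (Real.exp_pos (-1)).le
      linarith
    have hX0 : X ≤ 0 := by
      have h1 : E * Real.cos (Real.exp (-1) * y) ≤
          Real.exp ((Real.exp (-1) * y) ^ 2 / 2) * Real.exp (-((Real.exp (-1) * y) ^ 2 / 2)) := by
        rcases le_total (Real.cos (Real.exp (-1) * y)) 0 with h0 | h0
        · exact (mul_nonpos_of_nonneg_of_nonpos (by linarith) h0).trans (by positivity)
        · exact mul_le_mul (Real.exp_le_exp.2 hxy) hcos h0 (Real.exp_pos _).le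
      rw [← Real.exp_add] at h1
      simp only [add_neg_cancel, Real.exp_zero] at h1
      simp only [X]; linarith
    have hX0' : X = 0 := le_antisymm hX0 hX
    rw [hX0']
    constructor <;> nlinarith only [hE1]
  -- Away from the touching point crude bounds suffice: up to 1.8 the cosine is at most 0.75, and
  -- beyond 1.8 the modulus E is at least 3.4, so cos ≤ 1 will do.
  rcases le_total u 1.8 with h18 | h18
  · have hcos := cos_le_one_sub_sq_add_pow_four (Real.exp (-1) * y)
    have hY1 : 0.525 ≤ (Real.exp (-1) * y) ^ 2 := by
      rw [hY]
      have h1 : (3.511 : ℝ) ≤ Real.exp u := by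
        have := cubic_le_exp hu
        linarith [pow_le_pow_left₀ (by norm_num) h13 2, pow_le_pow_left₀ (by norm_num) h13 3]
      have h2 : (0.3168 : ℝ) ≤ Real.sin s ^ 2 := by
        refine le_trans ?_ hsin
        have : 0.36 ≤ s ^ 2 := by rw [hs]; nlinarith only [h13, h18]
        nlinarith only [this, hs1]
      calc (0.525 : ℝ) ≤ 0.36787 ^ 2 * 3.511 ^ 2 * 0.3168 := by norm_num
        _ ≤ _ := by gcongr
    have hY2 : (Real.exp (-1) * y) ^ 2 ≤ 9 := by
      rw [hY]
      have h1 : Real.exp u ≤ Real.exp 1 ^ 2 := by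
        rw [← Real.exp_nat_mul]; gcongr; push_cast; linarith
      have h2 : Real.exp 1 ^ 2 ≤ 8 := by nlinarith only [Real.exp_one_lt_d9, Real.exp_pos 1]
      calc _ ≤ (0.36788 : ℝ) ^ 2 * 8 ^ 2 * 1 := by gcongr <;> linarith
        _ ≤ 9 := by norm_num
    have hcos' : Real.cos (Real.exp (-1) * y) ≤ 0.75 := by
      rw [show (Real.exp (-1) * y) ^ 4 = ((Real.exp (-1) * y) ^ 2) ^ 2 by ring] at hcos
      linarith [mul_nonneg (sub_nonneg.2 hY1) (sub_nonneg.2 hY2)]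
    have hXE : X ≤ 0.75 * E - 1 := by simp only [X]; nlinarith only [hcos', hE1]
    have hN : E ^ 2 - 2.824 * E + 2.764 ≤ E ^ 2 - 1 - 3.764 * X := by linarith
    have hN0 : 0.7 ≤ E ^ 2 - 2.824 * E + 2.764 := by linarith [sq_nonneg (E - 1.412)]
    refine ⟨by linarith, ?_⟩
    have h1 := sq_nonneg (E ^ 2 - 1 - 3.764 * X - 1)
    linarith [sq_nonneg (E - 1.565)]
  · have h1 : (5.98 : ℝ) ≤ Real.exp u := by
      refine le_trans ?_ (Real.exp_le_exp.2 h18)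
      refine le_trans ?_ (quintic_le_exp (by norm_num))
      norm_num
    have h2 : 0.82 ≤ Real.cos s := by
      have := Real.one_sub_sq_div_two_le_cos (x := s)
      nlinarith only [this, hs, h18, hu2]
    have h3 : 3.9 ≤ x := by simp only [x]; nlinarith only [h1, h2]
    have h4 : 3.4 ≤ E := by
      have h5 : (1.43 : ℝ) ≤ Real.exp (-1) * x   := by nlinarith only [h3, i1]
      refine le_trans ?_ (Real.exp_le_exp.2 h5)
      refine le_trans ?_ (cubic_le_exp (by norm_num))
      norm_num
    have hXE : X ≤ E - 1 := by
      simp only [X]; nlinarith only [hE1, Real.cos_le_one (Real.exp (-1) * y)]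
    have h5 : (E - 1) * (E - 2.764) ≤ E ^ 2 - 1 - 3.764 * X := by linarith
    have h6 : 0 ≤ (E - 1) * (E - 2.764) := mul_nonneg (by linarith) (by linarith)
    refine ⟨h6.trans h5, ?_⟩
    have h7 := pow_le_pow_left₀ h6 h5 2
    refine le_trans ?_ h7
    have h8 : 0.8145 ≤ (E - 1) * (E - 2.764) ^ 2 := by
      have : (0.6:ℝ) ^ 2 ≤ (E - 2.764) ^ 2 := by gcongr; linarith
      nlinarith only [this, h4]
    nlinarith only [h8, hXE, h4]

theorem exp_one_sub_exp_one_gt : 0.1793 < Real.exp (1 - Real.exp 1) := by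
  have h1 : Real.exp (-1.7182818286) ≤ Real.exp (1 - Real.exp 1) :=
    Real.exp_le_exp.2 (by linarith [Real.exp_one_lt_d9])
  have h2 := Real.exp_bound' (x := 0.7182818286) (by norm_num) (by norm_num) (n := 7) (by norm_num)
  have h3 : Real.exp 1 * Real.exp 0.7182818286 * Real.exp (-1.7182818286) = 1 := by
    rw [← Real.exp_add, ← Real.exp_add]; norm_num
  have h4 := Real.exp_one_lt_d9
  have h5 : Real.exp 1 * Real.exp 0.7182818286 ≤ 5.577 := by
    calc _ ≤ (2.7182818286 : ℝ) * 2.0513 := mul_le_mul h4.le (h2.trans (by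
          norm_num [Finset.sum_range_succ, Nat.factorial]))
          (Real.exp_pos _).le (by norm_num)
      _ ≤ _ := by norm_num
  nlinarith only [h1, h3, h5, Real.exp_pos (-1.7182818286)]

/-- Near the minimum at w = 1, write m = X₀ exp δ with δ ≥ 0. The right side is (1 - m)² + 2m(1 -
cos y), so the loss in the first term must be paid by the second. Since exp δ - 1 ≤ δ exp δ, it
suffices that (1 - X₀)δ ≤ 1 - cos y; both sides are of first order in 1 - c, with different slopes.
-/
theorem one_sub_exp_circle_ge_near {c s : ℝ} (h : c ^ 2 + s ^ 2 = 1) (h9c : 0.9 ≤ c) :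
    let m := Real.exp (1 - Real.exp c * Real.cos s)
    let y := Real.exp c * Real.sin s
    (1 - Real.exp (1 - Real.exp 1)) ^ 2 ≤ 1 + m ^ 2 - 2 * m * Real.cos y := by
  intro m y
  have hX := exp_one_sub_exp_one_gt
  have hX1 : Real.exp (1 - Real.exp 1) ≤ 1 := Real.exp_le_one_iff.2 (by linarith [Real.exp_one_gt_d9])
  set X₀ := Real.exp (1 - Real.exp 1) with hX₀
  have hs : s ^ 2 = 1 - c ^ 2 := by linarith
  have hs1 : s ^ 2 ≤ 1 := by nlinarith only [hs, sq_nonneg c]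
  have hc1 : c ≤ 1 := by nlinarith only [h, sq_nonneg s]
  have hm : 0 < m := Real.exp_pos _
  have hcos := cos_le_one_sub_sq_add_pow_four y
  rw [show y ^ 4 = (y ^ 2) ^ 2 by ring] at hcos
  have hsin := sin_sq_ge (s := s) (by linarith)
  have hsin' : Real.sin s ^ 2 ≤ s ^ 2 := by
    rw [sq_le_sq]; exact Real.abs_sin_le_abs
  have hsin0 : 0 ≤ s ^ 2 * (1 - s ^ 2 / 3) := mul_nonneg (sq_nonneg _) (by linarith)
  have hY : y ^ 2 = Real.exp c ^ 2 * Real.sin s ^ 2 := by simp only [y]; ring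
  have hY1 : Real.exp c ^ 2 * (s ^ 2 * (1 - s ^ 2 / 3)) ≤ y ^ 2 := by rw [hY]; gcongr
  set e := Real.exp 1 with he
  have e1 : 2.718 < e := by linarith [Real.exp_one_gt_d9]
  have e2 : e < 2.719 := by linarith [Real.exp_one_lt_d9]
  set δ := e - Real.exp c * Real.cos s with hδ
  obtain ⟨u, rfl⟩ : ∃ u, c = 1 - u := ⟨1 - c, by ring⟩
  have hu0 : 0 ≤ u := by linarith
  have hu1 : u ≤ 0.1 := by linarith
  have hs' : s ^ 2 = u * (2 - u) := by rw [hs]; ring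
  have hec : e * (1 - u) ≤ Real.exp (1 - u) := by
    rw [sub_eq_add_neg, Real.exp_add]
    have := Real.add_one_le_exp (-u)
    gcongr
    linarith
  have hec' : Real.exp (1 - u) ≤ e := Real.exp_le_exp.2 (by linarith)
  have hδ0 : 0 ≤ δ := by
    have : Real.exp (1 - u) * Real.cos s ≤ Real.exp (1 - u) * 1 := by
      gcongr; exact Real.cos_le_one s
    linarith
  have hδ1 : δ ≤ e * (u * (2 - u)) := by
    have h1 : 1 - u ≤ Real.cos s := by
      have := Real.one_sub_sq_div_two_le_cos (x := s); linarith [sq_nonneg u]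
    have : e * (1 - u) * (1 - u) ≤ Real.exp (1 - u) * Real.cos s := by
      gcongr
    linarith
  have hYu : y ^ 2 ≤ 1.44 := by
    calc y ^ 2 ≤ 2.719 ^ 2 * 0.19 := by
          rw [hY]
          gcongr
          · linarith
          · exact hsin'.trans (by rw [hs']; nlinarith only [hu0, hu1])
      _ ≤ 1.44 := by norm_num
  have hYl : e ^ 2 * 0.755 * (u * (2 - u)) ≤ y ^ 2 := by
    refine le_trans ?_ hY1
    have h1 : (e * (1 - u)) ^ 2 ≤ Real.exp (1 - u) ^ 2 := by
      gcongr
    have h2 : 0.755 ≤ (1 - u) ^ 2 * (1 - s ^ 2 / 3) := by rw [hs']; nlinarith only [hu0, hu1, pow_nonneg hu0 2, pow_nonneg hu0 3]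
    rw [← hs']
    calc e ^ 2 * 0.755 * s ^ 2 ≤ e ^ 2 * ((1 - u) ^ 2 * (1 - s ^ 2 / 3)) * s ^ 2 := by gcongr
      _ = (e * (1 - u)) ^ 2 * (s ^ 2 * (1 - s ^ 2 / 3)) := by ring
      _ ≤ _ := by gcongr
  have hcosδ : (1 - X₀) * δ ≤ 1 - Real.cos y := by
    have h1 : 0.44 * y ^ 2 ≤ 1 - Real.cos y := by nlinarith only [hcos, hYu, sq_nonneg y]
    have h2 : (1 - X₀) * δ ≤ 0.821 * (e * (u * (2 - u))) :=
      mul_le_mul (by linarith) hδ1 hδ0 (by norm_num)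
    have h3 : 0 ≤ e * (u * (2 - u)) := by rw [← hs']; positivity
    nlinarith only [h1, h2, h3, hYl, e1]
  have hmδ : m = X₀ * Real.exp δ := by
    simp only [m, hX₀, hδ]; rw [← Real.exp_add]; congr 1; ring
  have hδe : Real.exp δ - 1 ≤ Real.exp δ * δ := by
    have h1 : Real.exp δ * Real.exp (-δ) = 1 := by rw [← Real.exp_add]; simp
    nlinarith only [h1, Real.add_one_le_exp (-δ), Real.exp_pos δ]
  have h1 : (1 - X₀) * (Real.exp δ - 1) ≤ Real.exp δ * (1 - Real.cos y) := by
    calc (1 - X₀) * (Real.exp δ - 1) ≤ (1 - X₀) * (Real.exp δ * δ) := by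
          apply mul_le_mul_of_nonneg_left hδe; linarith
      _ = Real.exp δ * ((1 - X₀) * δ) := by ring
      _ ≤ _ := by gcongr
  have h2 := mul_le_mul_of_nonneg_left h1 (show 0 ≤ X₀ by linarith)
  rw [hmδ]
  nlinarith only [h2, sq_nonneg (X₀ * (Real.exp δ - 1))]

/-- On the unit circle `|1 - exp (1 - exp w)|` is at least its value at `w = 1`. -/
theorem one_sub_exp_circle_ge {c s : ℝ} (h : c ^ 2 + s ^ 2 = 1) :
    let m := Real.exp (1 - Real.exp c * Real.cos s)
    let y := Real.exp c * Real.sin s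
    (1 - Real.exp (1 - Real.exp 1)) ^ 2 ≤ 1 + m ^ 2 - 2 * m * Real.cos y := by
  intro m y
  have hX := exp_one_sub_exp_one_gt
  have hX1 : Real.exp (1 - Real.exp 1) ≤ 1 := Real.exp_le_one_iff.2 (by linarith [Real.exp_one_gt_d9])
  set X₀ := Real.exp (1 - Real.exp 1) with hX₀
  have hX2 : (1 - X₀) ^ 2 ≤ 0.674 := by nlinarith only [hX, hX1]
  have hs : s ^ 2 = 1 - c ^ 2 := by linarith
  have hs1 : s ^ 2 ≤ 1 := by nlinarith only [hs, sq_nonneg c]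
  have hc1 : c ≤ 1 := by nlinarith only [h, sq_nonneg s]
  have hc2 : -1 ≤ c := by nlinarith only [h, sq_nonneg s]
  have hm : 0 < m := Real.exp_pos _
  have hcos := cos_le_one_sub_sq_add_pow_four y
  rw [show y ^ 4 = (y ^ 2) ^ 2 by ring] at hcos
  have hsin := sin_sq_ge (s := s) (by linarith)
  have hsin' : Real.sin s ^ 2 ≤ s ^ 2 := by
    rw [sq_le_sq]; exact Real.abs_sin_le_abs
  have hsin0 : 0 ≤ s ^ 2 * (1 - s ^ 2 / 3) := mul_nonneg (sq_nonneg _) (by linarith)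
  have hY : y ^ 2 = Real.exp c ^ 2 * Real.sin s ^ 2 := by simp only [y]; ring
  have hY1 : Real.exp c ^ 2 * (s ^ 2 * (1 - s ^ 2 / 3)) ≤ y ^ 2 := by rw [hY]; gcongr
  -- From 1 - c² ≤ exp(-c²) and 2c - c² ≤ 1 one gets y² ≤ e. This keeps y² in the range where the
  -- quartic bound for cos y decreases in y².
  have hY2 : y ^ 2 ≤ 2.72 := by
    have h1 : s ^ 2 ≤ Real.exp (-c ^ 2) := by linarith [Real.add_one_le_exp (-c ^ 2)]
    calc y ^ 2 ≤ Real.exp c ^ 2 * Real.exp (-c ^ 2) := by rw [hY]; gcongr; exact hsin'.trans h1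
      _ = Real.exp (2 * c - c ^ 2) := by rw [← Real.exp_nat_mul, ← Real.exp_add]; congr 1
      _ ≤ Real.exp 1 := by gcongr; nlinarith [sq_nonneg (c - 1)]
      _ ≤ 2.72 := by linarith [Real.exp_one_lt_d9]
  have hcos2 := Real.one_sub_sq_div_two_le_cos (x := y)
  have hexp1 : 0 < Real.exp c := Real.exp_pos c
  have hexpc : 1 + c ≤ Real.exp c := by linarith [Real.add_one_le_exp c]
  have hexpc' : Real.exp c * (1 - c) ≤ 1 := by
    have h1 : Real.exp c * Real.exp (-c) = 1 := by rw [← Real.exp_add]; simp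
    rw [← h1]
    gcongr
    linarith [Real.add_one_le_exp (-c)]
  have hM : c ≤ -0.3 → Real.exp c * Real.cos s ≤
      0.36788 + Real.exp c * ((1 + c) ^ 2 * (1 / 6 + (1 + c) ^ 3 / 120)) := by
    intro _
    have h1 := exp_mul_cos_le (u := 1 + c) (s := s) (by linarith) (by linarith)
    have h2 : Real.exp c = Real.exp (-1) * Real.exp (1 + c) := by
      rw [← Real.exp_add]; congr 1; ring
    have h3 := mul_le_mul_of_nonneg_left h1 (Real.exp_pos (-1)).le
    rw [h2]
    linarith [exp_neg_one_bounds.2]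
  have hsq : ∀ a b, a ≤ c → c ≤ b → c ^ 2 ≤ (a + b) * c - a * b := by
    intro a b ha hb
    linarith [mul_nonneg (sub_nonneg.2 ha) (sub_nonneg.2 hb)]
  have hst : ∀ τ, τ ≤ s ^ 2 → τ * (1 - τ / 3) ≤ s ^ 2 * (1 - s ^ 2 / 3) := by
    intro τ h
    have := mul_nonneg (sub_nonneg.2 h) (show 0 ≤ 1 - (τ + s ^ 2) / 3 by linarith)
    linarith
  have hck : ∀ τ, τ ≤ y ^ 2 → Real.cos y ≤ 1 - τ / 2 + τ ^ 2 / 24 := by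
    intro τ h
    have := mul_nonneg (sub_nonneg.2 h) (show 0 ≤ 1 / 2 - (τ + y ^ 2) / 24 by linarith)
    linarith
  -- The expression 1 + m² - 2mk decreases in k and increases in m for m ≥ k. Each range of c thus
  -- needs only a lower bound for m and an upper bound for cos y.
  have hfin : ∀ m₀ k, m₀ ≤ m → Real.cos y ≤ k → k ≤ m₀ → 0.674 ≤ 1 + m₀ ^ 2 - 2 * m₀ * k →
      (1 - X₀) ^ 2 ≤ 1 + m ^ 2 - 2 * m * Real.cos y := by
    intro m₀ k h1 h2 h3 h4
    have h5 := mul_le_mul_of_nonneg_left h2 hm.le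
    have h6 := mul_nonneg (sub_nonneg.2 h1) (show 0 ≤ m + m₀ - 2 * k by linarith)
    linarith
  rcases le_total c (-0.5) with hc5 | hc5
  · have hM4 : Real.exp c * Real.cos s ≤ 0.4 := by
      have h1 : Real.exp c ≤ 0.667 := by nlinarith only [hexpc', hexp1, hc5]
      have h2 : (1 + c) ^ 2 * (1 / 6 + (1 + c) ^ 3 / 120) ≤ 0.5 ^ 2 * (1 / 6 + 0.5 ^ 3 / 120) := by
        have : 1 + c ≤ 0.5 := by linarith
        have : 0 ≤ 1 + c := by linarith
        gcongr
      have h3 := hM (by linarith)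
      have h4 : 0 ≤ 1 + c := by linarith
      have := mul_le_mul h1 h2 (by positivity) (by norm_num)
      norm_num at this
      linarith
    have hm1 : 1.8214 ≤ m := by
      have h1 : (0.6 : ℝ) ≤ 1 - Real.exp c * Real.cos s := by linarith
      refine le_trans ?_ (Real.exp_le_exp.2 h1)
      refine le_trans ?_ (quintic_le_exp (by norm_num))
      norm_num
    exact hfin _ _ hm1 (Real.cos_le_one y) (by norm_num) (by norm_num)
  rcases le_total c (-0.3) with hc3 | hc3
  · have hM4 : Real.exp c * Real.cos s ≤ 0.45 := by
      have h1 : Real.exp c ≤ 0.77 := by nlinarith only [hexpc', hexp1, hc3]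
      have h2 : (1 + c) ^ 2 * (1 / 6 + (1 + c) ^ 3 / 120) ≤ 0.7 ^ 2 * (1 / 6 + 0.7 ^ 3 / 120) := by
        have : 1 + c ≤ 0.7 := by linarith
        have : 0 ≤ 1 + c := by linarith
        gcongr
      have h3 := hM (by linarith)
      have h4 : 0 ≤ 1 + c := by linarith
      have := mul_le_mul h1 h2 (by positivity) (by norm_num)
      norm_num at this
      linarith
    have hm1 : 1.7 ≤ m := by
      have h1 : (0.55 : ℝ) ≤ 1 - Real.exp c * Real.cos s := by linarith
      refine le_trans ?_ (Real.exp_le_exp.2 h1)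
      refine le_trans ?_ (cubic_le_exp (by norm_num))
      norm_num
    have hYl : 0.14 ≤ y ^ 2 := by
      have h1 : (0.5 : ℝ) ≤ Real.exp c := by linarith
      have h2 : 0.75 * 0.75 ≤ s ^ 2 * (1 - s ^ 2 / 3) := by
        have h3 : 0.75 ≤ s ^ 2 := by have := hsq (-0.5) (-0.3) (by linarith) (by linarith); linarith
        exact le_trans (by norm_num) (hst _ h3)
      refine le_trans ?_ hY1
      calc (0.14 : ℝ) ≤ 0.5 ^ 2 * (0.75 * 0.75) := by norm_num
        _ ≤ _ := by gcongr
    have hk : Real.cos y ≤ 0.932 := (hck _ hYl).trans (by norm_num)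
    exact hfin _ _ hm1 hk (by norm_num) (by norm_num)
  rcases le_total c 0 with hc0 | hc0
  · have hM4 : Real.exp c * Real.cos s ≤ 0.5417 := by
      have h3 := cos_le_one_sub_sq_add_pow_four s
      rw [show s ^ 4 = (s ^ 2) ^ 2 by ring, hs] at h3
      have h4 : 0 ≤ Real.cos s := Real.cos_nonneg_of_mem_Icc ⟨by nlinarith only [hs1, Real.pi_gt_three],
        by nlinarith only [hs1, Real.pi_gt_three]⟩
      have h5 : Real.exp c ≤ 1 + c + c ^ 2 / 2 := by
        have := exp_neg_le_quadratic (u := -c) (by linarith)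
        rw [neg_neg] at this
        linarith
      have h6 : 0 ≤ -c := by linarith
      have h7 : c ^ 2 ≤ 0.09 := by have := hsq (-0.3) 0 (by linarith) (by linarith); linarith
      have h8 : Real.exp c * Real.cos s ≤ (1 + c + c ^ 2 / 2) * (0.54167 + 0.5 * c ^ 2) := by
        refine mul_le_mul h5 ?_ h4 (by linarith)
        nlinarith only [h3, h7, sq_nonneg c]
      nlinarith only [h8, h6, h7, sq_nonneg c, hc3]
    have hm1 : 1.56 ≤ m := by
      have h1 : (0.458 : ℝ) ≤ 1 - Real.exp c * Real.cos s := by linarith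
      refine le_trans ?_ (Real.exp_le_exp.2 h1)
      refine le_trans ?_ (cubic_le_exp (by norm_num))
      norm_num
    have hYl : 0.3 ≤ y ^ 2 := by
      have h1 : (0.7 : ℝ) ≤ Real.exp c := by linarith
      have h2 : 0.91 * 0.69 ≤ s ^ 2 * (1 - s ^ 2 / 3) := by
        have h3 : 0.91 ≤ s ^ 2 := by have := hsq (-0.3) (0) (by linarith) (by linarith); linarith
        exact le_trans (by norm_num) (hst _ h3)
      refine le_trans ?_ hY1
      calc (0.3 : ℝ) ≤ 0.7 ^ 2 * (0.91 * 0.69) := by norm_num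
        _ ≤ _ := by gcongr
    have hk : Real.cos y ≤ 0.86 := (hck _ hYl).trans (by norm_num)
    exact hfin _ _ hm1 hk (by norm_num) (by norm_num)
  rcases le_total c 0.2 with h2c | h2c
  · have hM4 : Real.exp c * Real.cos s ≤ 0.7 := by
      have h1 : Real.exp c ≤ 1.25 := by nlinarith only [hexpc', hexp1, h2c]
      have h2 : Real.cos s ≤ 0.5584 := by
        have h3 := cos_le_one_sub_sq_add_pow_four s
        have h4 : 0.96 ≤ s ^ 2 := by have := hsq 0 0.2 hc0 h2c; linarith
        nlinarith only [h3, h4, hs1]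
      nlinarith only [h1, h2, hexp1]
    have hm1 : 1.3 ≤ m := by
      have h1 : (0.3 : ℝ) ≤ 1 - Real.exp c * Real.cos s := by linarith
      refine le_trans ?_ (Real.exp_le_exp.2 h1)
      refine le_trans ?_ (cubic_le_exp (by norm_num))
      norm_num
    have hYl : 0.64 ≤ y ^ 2 := by
      have h1 : (1 : ℝ) ≤ Real.exp c := by linarith
      have h2 : 0.96 * 0.667 ≤ s ^ 2 * (1 - s ^ 2 / 3) := by
        have h3 : 0.96 ≤ s ^ 2 := by have := hsq (0) (0.2) (by linarith) (by linarith); linarith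
        exact le_trans (by norm_num) (hst _ h3)
      refine le_trans ?_ hY1
      calc (0.64 : ℝ) ≤ 1 ^ 2 * (0.96 * 0.667) := by norm_num
        _ ≤ _ := by gcongr
    have hk : Real.cos y ≤ 0.7 := (hck _ hYl).trans (by norm_num)
    exact hfin _ _ hm1 hk (by norm_num) (by norm_num)
  -- For 0.2 ≤ c ≤ 0.9 no bound on m is needed: the expression equals (m - cos y)² + sin² y, and
  -- sin² y alone is large enough.
  rcases le_total c 0.9 with h9c | h9c
  · have hYl : 0.941 ≤ y ^ 2 := by
      refine le_trans ?_ hY1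
      have h1 := cubic_le_exp (u := 2 * c) (by linarith)
      rw [show Real.exp (2 * c) = Real.exp c ^ 2 by rw [← Real.exp_nat_mul]; simp] at h1
      refine le_trans ?_ (mul_le_mul_of_nonneg_right h1 hsin0)
      rw [hs]
      have h3 := mul_nonneg (sub_nonneg.2 h2c) (sub_nonneg.2 h9c)
      linarith [mul_nonneg (pow_nonneg hc0 2) h3, mul_nonneg (pow_nonneg hc0 3) h3,
        mul_nonneg (pow_nonneg hc0 4) h3, mul_nonneg (pow_nonneg hc0 5) h3, mul_nonneg hc0 h3]
    have hk : Real.cos y ≤ 0.567 := (hck _ hYl).trans (by norm_num)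
    have hk2 : Real.cos y ^ 2 ≤ 0.325 := by nlinarith only [hk, hcos2, hY2]
    linarith [sq_nonneg (m - Real.cos y)]
  · exact one_sub_exp_circle_ge_near h h9c

/-! ### The limaçon (4ω + ω²)/3 and its implicit inequality. -/

/-- With N = |ω|² and v = (4ω + ω²)/3, the difference 27(|v|² - 1)² - 32(1 + Re v) is a positive
multiple of (N - 1)(N + 15 + 8 Re ω) times a third factor. The condition |v| ≥ 1 makes that factor
positive, so the sign is that of N - 1. -/
theorem not_limacon_exterior {ω : ℂ} (hω : ‖ω‖ < 1) :
    ¬ (1 ≤ Complex.normSq ((4 * ω + ω ^ 2) / 3) ∧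
      32 * (1 + ((4 * ω + ω ^ 2) / 3).re) ≤
        27 * (Complex.normSq ((4 * ω + ω ^ 2) / 3) - 1) ^ 2) := by
  rintro ⟨h1, h2⟩
  have hN : Complex.normSq ω < 1 := by
    rw [Complex.normSq_eq_norm_sq]; exact (sq_lt_one_iff₀ (norm_nonneg _)).2 hω
  obtain ⟨a, b⟩ := ω
  rw [Complex.normSq_mk] at hN
  have hn : Complex.normSq ((4 * (⟨a, b⟩ : ℂ) + (⟨a, b⟩ : ℂ) ^ 2) / 3) =
      (a * a + b * b) * (a * a + b * b + 8 * a + 16) / 9 := by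
    rw [Complex.normSq_apply]
    simp [pow_two]
    ring
  have hr : ((4 * (⟨a, b⟩ : ℂ) + (⟨a, b⟩ : ℂ) ^ 2) / 3).re = (4 * a + a * a - b * b) / 3 := by
    simp [pow_two]
    ring
  rw [hn] at h1 h2
  rw [hr] at h2
  set N := a * a + b * b with hNdef
  have ha : -1 < a := by nlinarith only [hN, hNdef, mul_self_nonneg b, sq_nonneg (a + 1)]
  have hU : 0 ≤ N + 4 * a + 4 := by
    nlinarith only [hNdef, mul_self_nonneg b, sq_nonneg (a + 2)]
  have h3 : 0 ≤ ((N - 1) * (N + 15 + 8 * a)) * (N * (N + 8 * a + 16) - 7 + 2 * (N + 4 * a + 4)) := by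
    rw [show b * b = N - a * a by rw [hNdef]; ring] at h2
    linarith
  have h4 : 0 < N * (N + 8 * a + 16) - 7 + 2 * (N + 4 * a + 4) := by linarith
  have h5 : 0 < N + 15 + 8 * a := by nlinarith only [ha, hNdef, mul_self_nonneg b, mul_self_nonneg a]
  have h6 : 0 < ((1 - N) * (N + 15 + 8 * a)) * (N * (N + 8 * a + 16) - 7 + 2 * (N + 4 * a + 4)) :=
    mul_pos (mul_pos (by linarith) h5) h4
  linarith

theorem limacon_re_ge {ω : ℂ} (hω : ‖ω‖ < 1) : -1 ≤ ((4 * ω + ω ^ 2) / 3).re := by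
  have hN : Complex.normSq ω < 1 := by
    rw [Complex.normSq_eq_norm_sq]; exact (sq_lt_one_iff₀ (norm_nonneg _)).2 hω
  obtain ⟨a, b⟩ := ω
  rw [Complex.normSq_mk] at hN
  have hr : ((4 * (⟨a, b⟩ : ℂ) + (⟨a, b⟩ : ℂ) ^ 2) / 3).re = (4 * a + a * a - b * b) / 3 := by
    simp [pow_two]
    ring
  rw [hr]
  nlinarith only [hN, sq_nonneg (a + 1)]

theorem limacon_norm_lt {ω : ℂ} (hω : ‖ω‖ < 1) : ‖(4 * ω + ω ^ 2) / 3‖ < 5 / 3 := by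
  have h : ‖4 * ω + ω ^ 2‖ ≤ 4 * ‖ω‖ + ‖ω‖ ^ 2 := by
    refine (norm_add_le _ _).trans_eq ?_
    simp
  rw [norm_div]
  have h3 : ‖(3 : ℂ)‖ = 3 := by simp
  rw [h3]
  have : ‖ω‖ ^ 2 < 1 := (sq_lt_one_iff₀ (norm_nonneg _)).2 hω
  linarith

/-- Moves the origin to the touching point v = -1 and scales by K, through the identity K²(|v|² - 1)
= E² - 1 - 2(1 + K)x. The real estimates above are stated in these coordinates. -/
theorem limacon_exterior_of_scaled {K x y E : ℝ} {v : ℂ} (hK : 0 < K) (hx : K * (1 + v.re) = x)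
    (hy : K * v.im = y) (hE : (1 + x) ^ 2 + y ^ 2 = E ^ 2)
    (hN : 0 ≤ E ^ 2 - 1 - 2 * (1 + K) * x)
    (hNx : 32 * K ^ 3 * x ≤ 27 * (E ^ 2 - 1 - 2 * (1 + K) * x) ^ 2) :
    1 ≤ Complex.normSq v ∧ 32 * (1 + v.re) ≤ 27 * (Complex.normSq v - 1) ^ 2 := by
  have h1 : E ^ 2 - 1 - 2 * (1 + K) * x = K ^ 2 * (Complex.normSq v - 1) := by
    rw [← hE, ← hx, ← hy, Complex.normSq_apply]
    ring
  rw [h1] at hN hNx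
  constructor
  · have := nonneg_of_mul_nonneg_right hN (by positivity)
    linarith
  · rw [← hx] at hNx
    have h2 : K ^ 4 * (32 * (1 + v.re)) ≤ K ^ 4 * (27 * (Complex.normSq v - 1) ^ 2) := by linarith
    exact le_of_mul_le_mul_left h2 (by positivity)

/-! ### The images of the unit circle miss the limaçon domains. -/

theorem exp_ne_of_norm_eq_one {w ω : ℂ} (hw : ‖w‖ = 1) (hω : ‖ω‖ < 1) :
    Complex.exp w ≠ 1 + ((1 - Real.exp (-1) : ℝ) : ℂ) * ((4 * ω + ω ^ 2) / 3) := by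
  intro h
  apply not_limacon_exterior hω
  set v := (4 * ω + ω ^ 2) / 3
  have hn : w.re ^ 2 + w.im ^ 2 = 1 := by
    have : Complex.normSq w = 1 := by rw [Complex.normSq_eq_norm_sq, hw]; norm_num
    rw [Complex.normSq_apply] at this; linarith
  have hr1 : -1 ≤ w.re := by nlinarith only [hn, sq_nonneg w.im]
  have hr2 : w.re ≤ 1 := by nlinarith only [hn, sq_nonneg w.im]
  have hee : Real.exp 1 * Real.exp (-1) = 1 := by rw [← Real.exp_add]; simp
  have key := exp_circle_exterior (u := 1 + w.re) (s := w.im) (by linarith) (by linarith)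
    (by linarith)
  simp only at key
  have hre := congrArg Complex.re h
  have him := congrArg Complex.im h
  simp only [Complex.exp_re, Complex.exp_im, Complex.add_re, Complex.add_im, Complex.one_re,
    Complex.one_im, Complex.re_ofReal_mul, Complex.im_ofReal_mul] at hre him
  -- Multiplying the equation by e turns its right side into 1 + (e - 1)(1 + v), so that K = e - 1.
  have h1 : Real.exp (1 + w.re) * Real.cos w.im - 1 = (Real.exp 1 - 1) * (1 + v.re) := by
    rw [Real.exp_add, mul_assoc, hre]; linear_combination (-v.re) * hee
  have h2 : Real.exp (1 + w.re) * Real.sin w.im = (Real.exp 1 - 1) * v.im := by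
    rw [Real.exp_add, mul_assoc, him]; linear_combination (-v.im) * hee
  refine limacon_exterior_of_scaled (K := Real.exp 1 - 1) (E := Real.exp (1 + w.re))
    (by linarith [Real.exp_one_gt_d9]) h1.symm h2.symm ?_ ?_ ?_
  · linear_combination Real.exp (1 + w.re) ^ 2 * Real.sin_sq_add_cos_sq w.im
  · linarith [key.1]
  · convert key.2 using 3
    ring

theorem exp_exp_sub_one_ne_of_norm_eq_one {w ω : ℂ} (hw : ‖w‖ = 1) (hω : ‖ω‖ < 1) :
    Complex.exp (Complex.exp w - 1) ≠
      1 + ((1 - Real.exp (Real.exp (-1) - 1) : ℝ) : ℂ) * ((4 * ω + ω ^ 2) / 3) := by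
  intro h
  apply not_limacon_exterior hω
  set v := (4 * ω + ω ^ 2) / 3
  have hn : w.re ^ 2 + w.im ^ 2 = 1 := by
    have : Complex.normSq w = 1 := by rw [Complex.normSq_eq_norm_sq, hw]; norm_num
    rw [Complex.normSq_apply] at this; linarith
  have hr1 : -1 ≤ w.re := by nlinarith only [hn, sq_nonneg w.im]
  have hr2 : w.re ≤ 1 := by nlinarith only [hn, sq_nonneg w.im]
  have hee : Real.exp (-1) * Real.exp 1 = 1 := by rw [← Real.exp_add]; simp
  have key := bell_circle_exterior (u := 1 + w.re) (s := w.im) (by linarith) (by linarith)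
    (by linarith)
  simp only at key
  set x := Real.exp (1 + w.re) * Real.cos w.im - 1 with hx
  set y := Real.exp (1 + w.re) * Real.sin w.im with hy
  set κ := Real.exp (1 - Real.exp (-1)) with hκ
  have hκ1 : 1 < κ := Real.one_lt_exp_iff.2 (by linarith [exp_neg_one_bounds.2])
  have hκi : κ * Real.exp (Real.exp (-1) - 1) = 1 := by rw [hκ, ← Real.exp_add]; simp
  -- Multiplying by κ, the inverse of the value at w = -1, gives the scaled form with K = κ - 1.
  have hmul : Complex.exp (⟨Real.exp (-1) * x, Real.exp (-1) * y⟩) = 1 + ((κ - 1 : ℝ) : ℂ) * (1 + v) := by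
    have h1 : (⟨Real.exp (-1) * x, Real.exp (-1) * y⟩ : ℂ) =
        ((1 - Real.exp (-1) : ℝ) : ℂ) + (Complex.exp w - 1) := by
      apply Complex.ext
      · simp only [hx, Complex.add_re, Complex.sub_re, Complex.ofReal_re, Complex.exp_re,
          Complex.one_re, Real.exp_add]
        linear_combination Real.exp w.re * Real.cos w.im * hee
      · simp only [hy, Complex.add_im, Complex.sub_im, Complex.ofReal_im, Complex.exp_im,
          Complex.one_im, Real.exp_add]
        linear_combination Real.exp w.re * Real.sin w.im * hee
    rw [h1, Complex.exp_add, h, ← Complex.ofReal_exp, ← hκ]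
    have h2 : (κ : ℂ) * (Real.exp (Real.exp (-1) - 1) : ℝ) = 1 := by exact_mod_cast hκi
    push_cast at h2 ⊢
    linear_combination (-v) * h2
  have hre := congrArg Complex.re hmul
  have him := congrArg Complex.im hmul
  simp only [Complex.exp_re, Complex.exp_im, Complex.add_re, Complex.add_im, Complex.one_re,
    Complex.one_im, Complex.re_ofReal_mul, Complex.im_ofReal_mul, zero_add] at hre him
  refine limacon_exterior_of_scaled (K := κ - 1) (E := Real.exp (Real.exp (-1) * x))
    (x := Real.exp (Real.exp (-1) * x) * Real.cos (Real.exp (-1) * y) - 1)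
    (by linarith) (by linarith) him.symm ?_ ?_ ?_
  · linear_combination Real.exp (Real.exp (-1) * x) ^ 2 *
      Real.sin_sq_add_cos_sq (Real.exp (-1) * y)
  · linarith [key.1]
  · convert key.2 using 3
    ring

theorem exp_one_sub_exp_ne_of_norm_eq_one {w ω : ℂ} (hw : ‖w‖ = 1) (hω : ‖ω‖ < 1) :
    Complex.exp (1 - Complex.exp w) ≠
      1 - ((3 / 5 * (1 - Real.exp (1 - Real.exp 1)) : ℝ) : ℂ) * ((4 * ω + ω ^ 2) / 3) := by
  intro h
  have hv := limacon_norm_lt hω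
  set v := (4 * ω + ω ^ 2) / 3
  have hn : w.re ^ 2 + w.im ^ 2 = 1 := by
    have : Complex.normSq w = 1 := by rw [Complex.normSq_eq_norm_sq, hw]; norm_num
    rw [Complex.normSq_apply] at this; linarith
  have key := one_sub_exp_circle_ge hn
  simp only at key
  have hb : 0 < 1 - Real.exp (1 - Real.exp 1) := by
    have : Real.exp (1 - Real.exp 1) < 1 := 
      (Real.exp_lt_exp.2 (by linarith [Real.exp_one_gt_d9])).trans_eq Real.exp_zero
    linarith
  set b := 1 - Real.exp (1 - Real.exp 1)
  -- The factor 3/5 cancels the bound |v| < 5/3, so only the modulus of v matters here.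
  have h1 : ‖1 - Complex.exp (1 - Complex.exp w)‖ ^ 2 < b ^ 2 := by
    rw [h, sub_sub_cancel, norm_mul, Complex.norm_real, Real.norm_of_nonneg (by positivity)]
    apply pow_lt_pow_left₀ _ (by positivity) (by norm_num)
    nlinarith only [hv, hb]
  rw [← Complex.normSq_eq_norm_sq, Complex.normSq_apply] at h1
  simp only [Complex.sub_re, Complex.sub_im, Complex.one_re, Complex.one_im, Complex.exp_re,
    Complex.exp_im, zero_sub, Real.cos_neg, Real.sin_neg] at h1
  have h2 := Real.sin_sq_add_cos_sq (Real.exp w.re * Real.sin w.im)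
  have h3 : Real.exp (1 - Real.exp w.re * Real.cos w.im) ^ 2 *
      (Real.sin (Real.exp w.re * Real.sin w.im) ^ 2 +
        Real.cos (Real.exp w.re * Real.sin w.im) ^ 2) =
      Real.exp (1 - Real.exp w.re * Real.cos w.im) ^ 2 := by rw [h2, mul_one]
  linarith

/-! ### Starlikeness of the cardioid, Jack's lemma and the first-exit argument. -/

-- With H = 2u + u² one has 1 + H = (1 + u)², and |H|² - 1 - 2|1 + H| has the sign of |u|² - 1 on
-- the closed disc wherever the factor |u|² + 3 + 4 Re u is positive. Scaling by c is controlled by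
-- the triangle inequality c|1 + H| ≤ |1 + cH| + (1 - c).
open Complex in
theorem cardioid_starlike {u ζ : ℂ} {c : ℝ} (hu : ‖u‖ < 1) (hζ : ‖ζ‖ = 1) (hc0 : 0 < c)
    (hc1 : c ≤ 1) : 2 * ζ + ζ ^ 2 ≠ c * (2 * u + u ^ 2) := by
  intro h
  have hnorm : ∀ z : ℂ, ‖2 * z + z ^ 2‖ ^ 2 - 1 - 2 * ‖1 + (2 * z + z ^ 2)‖ =
      (‖z‖ ^ 2 - 1) * (‖z‖ ^ 2 + 3 + 4 * z.re) := by
    intro z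
    have h1 : ‖1 + (2 * z + z ^ 2)‖ = normSq (1 + z) := by
      rw [normSq_eq_norm_sq, ← norm_pow]; congr 1; ring
    rw [h1, ← normSq_eq_norm_sq, ← normSq_eq_norm_sq, normSq_apply, normSq_apply, normSq_apply]
    simp [pow_two]
    ring
  have h1 := hnorm ζ
  rw [hζ, h] at h1
  have h2 := hnorm u
  set H := 2 * u + u ^ 2
  have hu2 : ‖u‖ ^ 2 < 1 := (sq_lt_one_iff₀ (norm_nonneg _)).2 hu
  have h3 : 0 < ‖u‖ ^ 2 + 3 + 4 * u.re := by
    rw [← normSq_eq_norm_sq, normSq_apply] at hu2 ⊢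
    nlinarith [sq_nonneg (u.re + 1), mul_self_nonneg u.im]
  have h4 : ‖H‖ ^ 2 - 1 < 2 * ‖1 + H‖ := by nlinarith
  have h5 : ‖(c : ℂ) * H‖ = c * ‖H‖ := by
    rw [norm_mul, norm_real, Real.norm_of_nonneg hc0.le]
  have h6 : c * ‖1 + H‖ ≤ ‖1 + (c : ℂ) * H‖ + (1 - c) := by
    have h7 : (c : ℂ) * (1 + H) = (1 + c * H) - ((1 - c : ℝ) : ℂ) := by push_cast; ring
    have h8 : ‖(c : ℂ) * (1 + H)‖ = c * ‖1 + H‖ := by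
      rw [norm_mul, norm_real, Real.norm_of_nonneg hc0.le]
    rw [← h8, h7]
    refine (norm_sub_le _ _).trans_eq ?_
    rw [norm_real, Real.norm_of_nonneg (by linarith)]
  rw [h5] at h1
  have h9 : c * (‖H‖ ^ 2 - 1) < c * (2 * ‖1 + H‖) := by gcongr
  have h10 := norm_nonneg (1 + (c : ℂ) * H)
  rcases le_total 1 (c * ‖H‖ ^ 2) with h11 | h11
  · nlinarith [mul_nonneg (sub_nonneg.2 hc1) (sub_nonneg.2 h11)]
  · rcases hc1.lt_or_eq with h12 | rfl
    · have : c * (c * ‖H‖ ^ 2) < 1 := by nlinarith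
      nlinarith
    · nlinarith

theorem deriv_nonneg_of_nonneg_right {g : ℝ → ℝ} {g' : ℝ} (hg : HasDerivAt g g' 0) (h0 : g 0 = 0)
    (hpos : ∀ t, 0 < t → 0 ≤ g t) : 0 ≤ g' := by
  have h := (hg.hasDerivWithinAt (s := Set.Ioi 0))
  rw [hasDerivWithinAt_iff_tendsto_slope' (by simp)] at h
  refine ge_of_tendsto h ?_
  filter_upwards [self_mem_nhdsWithin] with t ht
  rw [slope_def_field, h0]
  exact div_nonneg (by linarith [hpos t ht]) (by linarith [Set.mem_Ioi.1 ht])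

open Complex in
/-- **Jack's lemma** at a boundary point where `ω` attains modulus one. -/
theorem jack {ω : ℂ → ℂ} {z₀ : ℂ} (hd : DifferentiableAt ℂ ω z₀) (hz₀ : z₀ ≠ 0)
    (hle : ∀ z, ‖z‖ < ‖z₀‖ → ‖ω z‖ * ‖z₀‖ ≤ ‖z‖) (hω : ‖ω z₀‖ = 1) :
    ∃ k : ℝ, 1 ≤ k ∧ z₀ * deriv ω z₀ = k * ω z₀ := by
  set m : ℂ := z₀ * deriv ω z₀ * (starRingEnd ℂ) (ω z₀) with hm
  -- Along the spiral z₀ exp(tσ), which enters the disc, the Schwarz bound makes exp(2t Re σ) - |ω|²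
  -- nonnegative for t > 0, with value 0 at t = 0. Its derivative at 0 is therefore nonnegative.
  -- Holding for every σ in the left half-plane, this forces m - 1 to be real and nonnegative.
  have key : ∀ σ : ℂ, σ.re < 0 → ((m - 1) * σ).re ≤ 0 := by
    intro σ hσ
    have hexp : HasDerivAt (fun t : ℝ => z₀ * exp (t * σ)) (z₀ * σ) 0 := by
      have h1 : HasDerivAt (fun t : ℝ => (t : ℂ) * σ) σ 0 := by
        simpa using (Complex.ofRealCLM.hasDerivAt (x := (0 : ℝ))).mul_const σ
      simpa using (h1.cexp).const_mul z₀
    have hcomp : HasDerivAt (fun t : ℝ => ω (z₀ * exp (t * σ))) (deriv ω z₀ * (z₀ * σ)) 0 := by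
      have h2 : HasDerivAt ω (deriv ω z₀) ((fun t : ℝ => z₀ * exp (t * σ)) 0) := by
        simpa using hd.hasDerivAt
      exact h2.comp (0 : ℝ) hexp
    have hF := hcomp.norm_sq
    have hE : HasDerivAt (fun t : ℝ => Real.exp (2 * σ.re * t)) (2 * σ.re) 0 := by
      simpa using ((hasDerivAt_id (0 : ℝ)).const_mul (2 * σ.re)).exp
    have h := deriv_nonneg_of_nonneg_right (hE.sub hF) (by simp [hω]) (by
      intro t ht
      have hn : ‖z₀ * exp (t * σ)‖ = ‖z₀‖ * Real.exp (t * σ.re) := by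
        rw [norm_mul, norm_exp]; simp
      have hz0 : 0 < ‖z₀‖ := norm_pos_iff.2 hz₀
      have h3 : ‖ω (z₀ * exp (t * σ))‖ ≤ Real.exp (t * σ.re) := by
        have h4 := hle (z₀ * exp (t * σ)) (by
          rw [hn]
          have : Real.exp (t * σ.re) < 1 := by
            rw [← Real.exp_zero]; exact Real.exp_lt_exp.2 (by nlinarith)
          nlinarith)
        rw [hn] at h4
        nlinarith
      have h5 := pow_le_pow_left₀ (norm_nonneg _) h3 2
      rw [← Real.exp_nat_mul] at h5
      have h6 : ((2 : ℕ) : ℝ) * (t * σ.re) = 2 * σ.re * t := by push_cast; ring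
      rw [h6] at h5
      simpa using h5)
    have h7 : inner ℝ (ω (z₀ * exp (((0 : ℝ) : ℂ) * σ))) (deriv ω z₀ * (z₀ * σ)) = (m * σ).re := by
      rw [Complex.inner]
      simp only [ofReal_zero, zero_mul, exp_zero, mul_one, hm]
      congr 1
      ring
    rw [h7] at h
    rw [sub_mul, sub_re, one_mul]
    linarith
  have him : m.im = 0 := by
    by_contra hne
    -- A direction whose imaginary part outweighs the contribution of Re m, with sign opposite to Im
    -- m.
    have h1 := key ⟨-|m.im|, -(|m.re| + 2) * SignType.sign m.im⟩ (by simpa using hne)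
    simp only [mul_re, sub_re, sub_im, one_re, one_im, sub_zero] at h1
    have h2 : m.im * (SignType.sign m.im : ℝ) = |m.im| := by
      rw [mul_comm]; exact sign_mul_self m.im
    have h3 : 0 < |m.im| := abs_pos.2 hne
    have h4 := le_abs_self m.re
    have h5 : (m.re - 1) * -|m.im| - m.im * (-(|m.re| + 2) * (SignType.sign m.im : ℝ)) =
        |m.im| * (|m.re| + 3 - m.re) := by linear_combination (|m.re| + 2) * h2
    have h6 : 0 < |m.im| * (|m.re| + 3 - m.re) := mul_pos h3 (by linarith)
    linarith
  have hre : 1 ≤ m.re := by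
    have h1 := key (-1) (by simp)
    simp at h1
    linarith
  refine ⟨m.re, hre, ?_⟩
  have h1 : (m.re : ℂ) = m := Complex.ext (by simp) (by simp [him])
  rw [h1, hm, mul_assoc, mul_comm ((starRingEnd ℂ) (ω z₀)), mul_conj, normSq_eq_norm_sq, hω]
  simp

/-- The limaçon map is a translated square, and Re(ω + 2) ≥ 1 on the closed disc. Hence the
principal square root inverts it holomorphically up to and across the boundary, as Jack's lemma at a
boundary value requires. -/
theorem limacon_sq (ω : ℂ) : 3 * ((4 * ω + ω ^ 2) / 3) + 4 = (ω + 2) ^ 2 := by ring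

theorem limacon_mem_slitPlane {ω : ℂ} (hω : ‖ω‖ ≤ 1) :
    3 * ((4 * ω + ω ^ 2) / 3) + 4 ∈ Complex.slitPlane := by
  have h1 : -1 ≤ ω.re := by linarith [neg_le_of_abs_le (Complex.abs_re_le_norm ω)]
  rw [limacon_sq, Complex.mem_slitPlane_iff]
  simp only [pow_two, Complex.mul_re, Complex.mul_im, Complex.add_re, Complex.add_im,
    Complex.re_ofNat, Complex.im_ofNat, add_zero]
  by_cases h : ω.im = 0
  · left; rw [h]; nlinarith
  · right
    have h2 : 0 < ω.re + 2 := by linarith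
    intro h3
    have h4 : (ω.re + 2) * ω.im = 0 := by linarith
    exact (mul_ne_zero h2.ne' h) h4

/-- The inverse of `ω ↦ (4ω + ω²)/3` on the closed unit disc. -/
noncomputable def limaconInv (v : ℂ) : ℂ := (3 * v + 4) ^ (2⁻¹ : ℂ) - 2

theorem limaconInv_limacon {ω : ℂ} (hω : ‖ω‖ ≤ 1) : limaconInv ((4 * ω + ω ^ 2) / 3) = ω := by
  have h1 : -1 ≤ ω.re := by linarith [neg_le_of_abs_le (Complex.abs_re_le_norm ω)]
  rw [limaconInv, limacon_sq, Complex.sq_cpow_two_inv (by simp; linarith)]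
  ring

theorem limacon_limaconInv (v : ℂ) : (4 * limaconInv v + limaconInv v ^ 2) / 3 = v := by
  have h : ((3 * v + 4) ^ (2⁻¹ : ℂ)) ^ 2 = 3 * v + 4 := by
    simp
  rw [limaconInv]
  linear_combination h / 3

theorem differentiableAt_limaconInv {v : ℂ} (hv : 3 * v + 4 ∈ Complex.slitPlane) :
    DifferentiableAt ℂ limaconInv v := by
  unfold limaconInv
  exact (DifferentiableAt.cpow (f := fun v => 3 * v + 4) (by fun_prop)
    (differentiableAt_const _) hv).sub_const 2

def limaconDomain : Set ℂ := (fun ω : ℂ => (4 * ω + ω ^ 2) / 3) '' Metric.ball 0 1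

theorem isOpen_limaconDomain : IsOpen limaconDomain := by
  have h : limaconDomain = {v | 3 * v + 4 ∈ Complex.slitPlane} ∩ limaconInv ⁻¹' Metric.ball 0 1 := by
    ext v
    constructor
    · rintro ⟨ω, hω, rfl⟩
      rw [mem_ball_zero_iff] at hω
      refine ⟨limacon_mem_slitPlane hω.le, ?_⟩
      simpa [limaconInv_limacon hω.le] using hω
    · rintro ⟨_, h⟩
      exact ⟨_, h, limacon_limaconInv v⟩
  rw [h]
  have hopen : IsOpen {v : ℂ | 3 * v + 4 ∈ Complex.slitPlane} :=
    Complex.isOpen_slitPlane.preimage (by fun_prop)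
  refine ContinuousOn.isOpen_inter_preimage ?_ hopen Metric.isOpen_ball
  exact fun v hv => (differentiableAt_limaconInv hv).continuousAt.continuousWithinAt

/-- If `z v'(z)` takes values in the starlike domain bounded by the cardioid
`{(4u + 2u²)/3}`, then `v` takes values in the domain bounded by the limaçon `{(4ω + ω²)/3}`. -/
theorem mem_limaconDomain {v : ℂ → ℂ} (hv : DifferentiableOn ℂ v (Metric.ball 0 1))
    (hv0 : v 0 = 0)
    (h : ∀ z ∈ Metric.ball (0 : ℂ) 1, ∃ u : ℂ, ∃ c : ℝ, ‖u‖ < 1 ∧ 0 < c ∧ c ≤ 1 ∧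
      z * deriv v z = c * ((4 * u + 2 * u ^ 2) / 3)) :
    ∀ z ∈ Metric.ball (0 : ℂ) 1, v z ∈ limaconDomain := by
  by_contra! hcon
  obtain ⟨z₁, hz₁, hvz₁⟩ := hcon
  have hsub : Metric.closedBall (0 : ℂ) ‖z₁‖ ⊆ Metric.ball 0 1 :=
    Metric.closedBall_subset_ball (by simpa using hz₁)
  have hK : IsCompact (Metric.closedBall (0 : ℂ) ‖z₁‖ ∩ v ⁻¹' limaconDomainᶜ) :=
    (isCompact_closedBall _ _).of_isClosed_subset
      ((hv.continuousOn.mono hsub).preimage_isClosed_of_isClosed Metric.isClosed_closedBall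
        isOpen_limaconDomain.isClosed_compl) Set.inter_subset_left
  -- A point of least modulus where v is outside the open domain; all points of smaller modulus are
  -- mapped inside it.
  obtain ⟨z₀, hz₀, hmin⟩ := hK.exists_isMinOn ⟨z₁, by simp, hvz₁⟩ continuous_norm.continuousOn
  have hz₀1 : ‖z₀‖ ≤ ‖z₁‖ := by simpa using hz₀.1
  have hz₀b : z₀ ∈ Metric.ball (0 : ℂ) 1 := hsub hz₀.1
  have hin : ∀ z, ‖z‖ < ‖z₀‖ → v z ∈ limaconDomain := by
    intro z hz
    by_contra hne
    exact absurd (hmin (show z ∈ _ from ⟨by simpa using (hz.trans_le hz₀1).le, hne⟩)) (by simpa using hz)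
  have hz₀ne : z₀ ≠ 0 := by
    rintro rfl
    exact hz₀.2 ⟨0, by simp, by simp [hv0]⟩
  have hr : 0 < ‖z₀‖ := norm_pos_iff.2 hz₀ne
  have hball : Metric.ball (0 : ℂ) ‖z₀‖ ⊆ Metric.ball 0 1 :=
    Metric.ball_subset_ball (by simpa using (mem_ball_zero_iff.1 hz₀b).le)
  obtain ⟨ζ, hζ, hvζ⟩ : v z₀ ∈ (fun ω : ℂ => (4 * ω + ω ^ 2) / 3) '' Metric.closedBall 0 1 := by
    have hcl : IsClosed ((fun ω : ℂ => (4 * ω + ω ^ 2) / 3) '' Metric.closedBall 0 1) :=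
      ((isCompact_closedBall _ _).image (by fun_prop)).isClosed
    rw [← hcl.closure_eq]
    have hc : ContinuousWithinAt v (Metric.ball 0 ‖z₀‖) z₀ :=
      (hv.continuousOn z₀ hz₀b).mono hball
    refine hc.mem_closure (by rw [closure_ball _ hr.ne']; simp) ?_
    intro z hz
    exact Set.image_mono Metric.ball_subset_closedBall (hin z (by simpa using hz))
  simp only at hvζ
  have hζ1 : ‖ζ‖ ≤ 1 := by simpa using hζ
  have hζeq : ‖ζ‖ = 1 := by
    refine hζ1.antisymm (not_lt.1 fun hlt => hz₀.2 ⟨ζ, by simpa using hlt, hvζ⟩)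
  have hinvζ : limaconInv (v z₀) = ζ := by rw [← hvζ]; exact limaconInv_limacon hζ1
  have hdiffv : ∀ z ∈ Metric.ball (0 : ℂ) 1, DifferentiableAt ℂ v z := fun z hz =>
    hv.differentiableAt (Metric.isOpen_ball.mem_nhds hz)
  have hωd₀ : DifferentiableAt ℂ (fun z => limaconInv (v z)) z₀ :=
    DifferentiableAt.comp (g := limaconInv) z₀ (differentiableAt_limaconInv (by
      rw [← hvζ]; exact limacon_mem_slitPlane hζ1)) (hdiffv z₀ hz₀b)
  have hωd : DifferentiableOn ℂ (fun z => limaconInv (v z)) (Metric.ball 0 ‖z₀‖) := by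
    intro z hz
    obtain ⟨ω, hω, hvω⟩ := hin z (by simpa using hz)
    refine DifferentiableAt.differentiableWithinAt ?_
    refine DifferentiableAt.comp (g := limaconInv) z (differentiableAt_limaconInv ?_)
      (hdiffv z (hball hz))
    rw [← hvω]
    exact limacon_mem_slitPlane (by simpa using (mem_ball_zero_iff.1 hω).le)
  have hω0 : limaconInv (v 0) = 0 := by
    have := limaconInv_limacon (ω := 0) (by simp)
    simpa [hv0] using this
  have hschwarz : ∀ z, ‖z‖ < ‖z₀‖ → ‖limaconInv (v z)‖ * ‖z₀‖ ≤ ‖z‖ := by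
    intro z hz
    have h1 := Complex.dist_le_div_mul_dist_of_mapsTo_ball (R₂ := 1) hωd (by
      intro y hy
      obtain ⟨ω, hω, hvω⟩ := hin y (by simpa using hy)
      rw [mem_ball_zero_iff] at hω
      simp only [hω0, ← hvω, limaconInv_limacon hω.le]
      simpa using hω.le) (z := z) (by simpa using hz)
    simp only [hω0, dist_zero_right] at h1
    calc ‖limaconInv (v z)‖ * ‖z₀‖ ≤ 1 / ‖z₀‖ * ‖z‖ * ‖z₀‖ := by gcongr
      _ = ‖z‖ := by field_simp
  obtain ⟨k, hk, hjack⟩ := jack hωd₀ hz₀ne hschwarz (by simpa [hinvζ] using hζeq)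
  simp only [hinvζ] at hjack
  have hderiv : deriv v z₀ = (4 + 2 * ζ) / 3 * deriv (fun z => limaconInv (v z)) z₀ := by
    have h1 : v = fun z => (4 * limaconInv (v z) + limaconInv (v z) ^ 2) / 3 := by
      ext z; rw [limacon_limaconInv]
    have h2 := (((hωd₀.hasDerivAt.const_mul 4).add (hωd₀.hasDerivAt.pow 2)).div_const 3)
    rw [← hinvζ]
    nth_rewrite 1 [h1]
    exact (HasDerivAt.deriv h2).trans (by push_cast; ring)
  obtain ⟨u, c, hu, hc0, hc1, hzc⟩ := h z₀ hz₀b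
  have hk0 : 0 < k := by linarith
  -- Jack's factor k ≥ 1 goes to the other side and shrinks the cardioid further, by c/k ≤ 1.
  apply cardioid_starlike (c := c / k) hu hζeq (by positivity) ((div_le_one hk0).2 (by linarith))
  have hkc : (k : ℂ) ≠ 0 := by exact_mod_cast hk0.ne'
  rw [hderiv] at hzc
  push_cast
  field_simp
  linear_combination (3 / 2 : ℂ) * hzc - ((4 + 2 * ζ) / 2) * hjack

/-! ### Analytic continuation from a neighbourhood of 0 to the disc. -/

open Filter Topology

theorem isOpen_unitDisc : IsOpen unitDisc := Metric.isOpen_ball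

theorem zero_mem_unitDisc : (0 : ℂ) ∈ unitDisc := by simp [unitDisc]

theorem isPreconnected_unitDisc : IsPreconnected unitDisc :=
  (convex_ball (0 : ℂ) 1).isPreconnected

theorem removeSing_eqOn {F A : ℂ → ℂ} (hF : MeromorphicOn F unitDisc)
    (hA : AnalyticOnNhd ℂ A unitDisc) (h : ∀ x ∈ unitDisc, F =ᶠ[𝓝[≠] x] A) :
    Set.EqOn (removeSing F) A unitDisc := by
  intro x hx
  rw [removeSing, toMeromorphicNFOn_eq_toMeromorphicNFAt hF hx,
    (toMeromorphicNFAt_eventuallyEq_nhds_congr (h x hx)).eq_of_nhds,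
    toMeromorphicNFAt_eq_self.2 (hA x hx).meromorphicNFAt]

theorem classA_eventually_ne_zero {f : ℂ → ℂ} (hf : f ∈ classA) {x : ℂ} (hx : x ∈ unitDisc) :
    ∀ᶠ z in 𝓝[≠] x, f z ≠ 0 := by
  refine (hf.1 x hx).eventually_eq_zero_or_eventually_ne_zero.resolve_left fun h => ?_
  have h0 := hf.1.eqOn_zero_of_preconnected_of_eventuallyEq_zero isPreconnected_unitDisc hx h
  have h1 : f =ᶠ[𝓝 0] fun _ => 0 := by
    filter_upwards [isOpen_unitDisc.mem_nhds zero_mem_unitDisc] with z hz using h0 hz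
  have h2 := hf.2.2
  rw [h1.deriv_eq] at h2
  simp at h2

theorem meromorphicOn_starQuot {f : ℂ → ℂ} (hf : f ∈ classA) :
    MeromorphicOn (starQuot f) unitDisc := fun x hx =>
  (analyticAt_id.meromorphicAt.mul (hf.1 x hx).deriv.meromorphicAt).div (hf.1 x hx).meromorphicAt

theorem meromorphicOn_frakM {f : ℂ → ℂ} (hf : f ∈ classA) :
    MeromorphicOn (frakM f) unitDisc := fun x hx =>
  ((MeromorphicAt.const 1 x).sub (meromorphicOn_starQuot hf x hx)).add
    ((analyticAt_id.meromorphicAt.mul (hf.1 x hx).deriv.deriv.meromorphicAt).div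
      (hf.1 x hx).deriv.meromorphicAt)

/-- Take P = f'/(f/z), analytic at 0 because f/z has value 1 there. Differentiating zf' = fP gives
the formula for 𝔐. -/
theorem exists_starQuot_extension {f : ℂ → ℂ} (hf : f ∈ classA) :
    ∃ P : ℂ → ℂ, AnalyticAt ℂ P 0 ∧ P 0 = 1 ∧ (∀ᶠ z in 𝓝 0, z * deriv f z = f z * P z) ∧
      ∀ᶠ z in 𝓝[≠] 0, starQuot f z = P z ∧ P z ≠ 0 ∧ frakM f z = z * deriv P z / P z := by
  obtain ⟨hfa, hf0, hf1⟩ := hf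
  have hfa0 := hfa 0 zero_mem_unitDisc
  have hk : AnalyticAt ℂ (dslope f 0) 0 := by
    have h := (Complex.differentiableOn_dslope (isOpen_unitDisc.mem_nhds zero_mem_unitDisc)).2
      hfa.differentiableOn
    exact h.analyticAt (isOpen_unitDisc.mem_nhds zero_mem_unitDisc)
  have hk0 : dslope f 0 0 = 1 := by rw [dslope_same, hf1]
  have hfk : ∀ z, f z = z * dslope f 0 z := by
    intro z
    have := sub_smul_dslope f 0 z
    simpa [hf0] using this.symm
  have hPa : AnalyticAt ℂ (fun z => deriv f z / dslope f 0 z) 0 :=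
    hfa0.deriv.div hk (by rw [hk0]; exact one_ne_zero)
  have hkne : ∀ᶠ z in 𝓝 0, dslope f 0 z ≠ 0 :=
    hk.continuousAt.eventually_ne (by rw [hk0]; exact one_ne_zero)
  have hdne : ∀ᶠ z in 𝓝 0, deriv f z ≠ 0 :=
    hfa0.deriv.continuousAt.eventually_ne (by rw [hf1]; exact one_ne_zero)
  have hmul : ∀ᶠ z in 𝓝 0, z * deriv f z = f z * (deriv f z / dslope f 0 z) := by
    filter_upwards [hkne] with z hz
    rw [hfk z]
    field_simp
  refine ⟨fun z => deriv f z / dslope f 0 z, hPa, by simp [hf1], hmul, ?_⟩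
  set P : ℂ → ℂ := fun z => deriv f z / dslope f 0 z
  have hne : ∀ᶠ z : ℂ in 𝓝[≠] 0, z ≠ 0 := self_mem_nhdsWithin
  filter_upwards [hne, hkne.filter_mono nhdsWithin_le_nhds, hdne.filter_mono nhdsWithin_le_nhds,
    hmul.eventually_nhds.filter_mono nhdsWithin_le_nhds,
    hPa.eventually_analyticAt.filter_mono nhdsWithin_le_nhds,
    hfa0.eventually_analyticAt.filter_mono nhdsWithin_le_nhds] with z h1 h2 h3 h4 h5 h6
  have hfz : f z ≠ 0 := by rw [hfk z]; exact mul_ne_zero h1 h2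
  have hPz : starQuot f z = P z := by
    rw [starQuot, div_eq_iff hfz, mul_comm (P z)]
    exact h4.self_of_nhds
  have hPne : P z ≠ 0 := div_ne_zero h3 h2
  refine ⟨hPz, hPne, ?_⟩
  have hd : deriv (fun z => z * deriv f z) z = deriv (fun z => f z * P z) z :=
    EventuallyEq.deriv_eq h4
  have hd1 : HasDerivAt (fun z => z * deriv f z) (1 * deriv f z + z * deriv (deriv f) z) z :=
    (hasDerivAt_id z).mul h6.deriv.differentiableAt.hasDerivAt
  have hd2 : HasDerivAt (fun z => f z * P z) (deriv f z * P z + f z * deriv P z) z :=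
    h6.differentiableAt.hasDerivAt.mul h5.differentiableAt.hasDerivAt
  rw [hd1.deriv, hd2.deriv] at hd
  have h7 : z * deriv f z = f z * P z := h4.self_of_nhds
  rw [eq_div_iff hPne, frakM]
  field_simp
  have h8 : P z = z * deriv f z / f z := by rw [eq_div_iff hfz, h7]; ring
  have h9 : f z * deriv P z = deriv f z + z * deriv (deriv f) z - deriv f z * P z := by
    linear_combination -hd
  have h10 : deriv P z = (deriv f z + z * deriv (deriv f) z - deriv f z * P z) / f z := by
    rw [eq_div_iff hfz, ← h9]; ring
  rw [h10, h8]
  field_simp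
  ring

/-- The common engine of the three cases. Although R is known only near 0, (Φ - 1)/(βz), with Φ the
regularised T, is analytic on the whole disc, and its primitive g vanishing at 0 continues R. -/
theorem exists_limacon_valued_primitive {T R : ℂ → ℂ} {β b : ℝ} (hT : MeromorphicOn T unitDisc)
    (hsub : Subordinate (removeSing T) phiC) (hb : 0 < b) (hβ : 1 / b ≤ β)
    (hR : AnalyticAt ℂ R 0) (hR0 : R 0 = 0)
    (hTR : ∀ᶠ z in 𝓝[≠] 0, T z = 1 + β * (z * deriv R z)) :
    ∃ g : ℂ → ℂ, DifferentiableOn ℂ g unitDisc ∧ g =ᶠ[𝓝 0] R ∧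
      ∀ z ∈ unitDisc, ∃ ω : ℂ, ‖ω‖ < 1 ∧ g z = b * ((4 * ω + ω ^ 2) / 3) := by
  have hb1 : 0 < 1 / b := by positivity
  have hβ0 : 0 < β := by linarith
  have hβne : (β : ℂ) ≠ 0 := by exact_mod_cast hβ0.ne'
  obtain ⟨hΦ, -, w, hw, hw0, hw1, hΦw⟩ := hsub
  set Φ := removeSing T with hΦdef
  have hnhds := isOpen_unitDisc.mem_nhds zero_mem_unitDisc
  have hΦ0 : Φ 0 = 1 := by rw [hΦw 0 zero_mem_unitDisc, hw0]; simp [phiC]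
  have hΦT : Φ =ᶠ[𝓝[≠] 0] T := hT.toMeromorphicNFOn_eq_self_on_nhdsNE zero_mem_unitDisc
  have hq : DifferentiableOn ℂ (fun z => dslope Φ 0 z / β) unitDisc :=
    ((Complex.differentiableOn_dslope hnhds).2 hΦ.differentiableOn).div_const _
  obtain ⟨g, hg0, hg⟩ := hq.isExactOn_ball.with_val_at 0 0
  have hgd : DifferentiableOn ℂ g unitDisc := fun z hz =>
    (hg z hz).differentiableAt.differentiableWithinAt
  have hzg : ∀ z ∈ unitDisc, z * deriv g z = (Φ z - 1) / β := by
    intro z hz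
    have h := sub_smul_dslope Φ 0 z
    rw [(hg z hz).deriv, ← hΦ0, ← h]
    simp
    ring
  refine ⟨g, hgd, ?_, ?_⟩
  · have hga : AnalyticAt ℂ g 0 := hgd.analyticAt hnhds
    have hne : ∀ᶠ z : ℂ in 𝓝[≠] 0, z ≠ 0 := self_mem_nhdsWithin
    have h1 : deriv g =ᶠ[𝓝[≠] 0] deriv R := by
      filter_upwards [hne, hΦT, hTR, mem_nhdsWithin_of_mem_nhds hnhds] with z h1 h2 h3 h4
      have h5 := hzg z h4
      rw [h2, h3] at h5
      apply mul_left_cancel₀ h1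
      rw [h5]
      field_simp
      ring
    have h2 : deriv g =ᶠ[𝓝 0] deriv R :=
      (hga.deriv.continuousAt.eventuallyEq_nhds_iff_eventuallyEq_nhdsNE
        hR.deriv.continuousAt).1 h1
    obtain ⟨ε, hε, h3⟩ := Metric.eventually_nhds_iff_ball.1
      (h2.and (hga.eventually_analyticAt.and hR.eventually_analyticAt))
    filter_upwards [Metric.ball_mem_nhds (0 : ℂ) hε] with z hz
    refine Metric.isOpen_ball.eqOn_of_deriv_eq (convex_ball (0 : ℂ) ε).isPreconnected
      (fun y hy => (h3 y hy).2.1.differentiableAt.differentiableWithinAt)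
      (fun y hy => (h3 y hy).2.2.differentiableAt.differentiableWithinAt)
      (fun y hy => (h3 y hy).1) (Metric.mem_ball_self hε) (by rw [hg0, hR0]) hz
  · have hbne : (b : ℂ) ≠ 0 := by exact_mod_cast hb.ne'
    have hv := mem_limaconDomain (v := fun z => g z / b) (hgd.div_const _) (by simp [hg0]) (by
      intro z hz
      -- The shrinking factor is 1/(bβ), at most 1 exactly when β ≥ 1/b.
      refine ⟨w z, 1 / b / β, hw1 z hz, by positivity, (div_le_one hβ0).2 hβ, ?_⟩
      rw [((hg z hz).div_const (b : ℂ)).deriv, ← (hg z hz).deriv, mul_div_assoc', hzg z hz,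
        hΦw z hz, phiC]
      push_cast
      field_simp
      ring)
    intro z hz
    obtain ⟨ω, hω, h⟩ := hv z hz
    refine ⟨ω, by simpa using hω, ?_⟩
    simp only at h
    rw [h]
    field_simp

theorem norm_lt_one_of_norm_ne_one {W : ℂ → ℂ} (hW : ContinuousOn W unitDisc) (hW0 : W 0 = 0)
    (h : ∀ z ∈ unitDisc, ‖W z‖ ≠ 1) {z : ℂ} (hz : z ∈ unitDisc) : ‖W z‖ < 1 := by
  by_contra! hcon
  obtain ⟨y, hy, hy1⟩ := isPreconnected_unitDisc.intermediate_value zero_mem_unitDisc hz hW.norm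
    (show (1 : ℝ) ∈ Set.Icc _ _ from ⟨by simp [hW0], hcon⟩)
  exact h y hy hy1

/-- The relation zf' = fP spreads from a neighbourhood of 0 to the disc by the identity theorem. As
P is analytic on the disc, this rules out poles of zf'/f, so its regularisation is P. -/
theorem mem_starlikeB_of_eq {f P₀ P W : ℂ → ℂ} (hf : f ∈ classA)
    (hP₀ : ∀ᶠ z in 𝓝 0, z * deriv f z = f z * P₀ z) (hPP₀ : P =ᶠ[𝓝 0] P₀)
    (hW : DifferentiableOn ℂ W unitDisc) (hW0 : W 0 = 0) (hW1 : ∀ z ∈ unitDisc, ‖W z‖ ≠ 1)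
    (hPW : ∀ z ∈ unitDisc, P z = bellQ (W z)) : f ∈ starlikeB := by
  have hQ : AnalyticOnNhd ℂ bellQ unitDisc := fun z _ => by
    unfold bellQ
    fun_prop
  have hWa : AnalyticOnNhd ℂ W unitDisc := hW.analyticOnNhd isOpen_unitDisc
  have hPa : AnalyticOnNhd ℂ P unitDisc := by
    have : AnalyticOnNhd ℂ (fun z => bellQ (W z)) unitDisc := by
      intro z hz
      have := hWa z hz
      unfold bellQ
      fun_prop
    exact this.congr isOpen_unitDisc fun z hz => (hPW z hz).symm
  have hmul : Set.EqOn (fun z => z * deriv f z) (fun z => f z * P z) unitDisc := by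
    refine AnalyticOnNhd.eqOn_of_preconnected_of_eventuallyEq
      (fun z hz => analyticAt_id.mul (hf.1 z hz).deriv) (fun z hz => (hf.1 z hz).mul (hPa z hz))
      isPreconnected_unitDisc zero_mem_unitDisc ?_
    filter_upwards [hP₀, hPP₀] with z h1 h2
    rw [h1, h2]
  have heq : Set.EqOn (removeSing (starQuot f)) P unitDisc := by
    refine removeSing_eqOn (meromorphicOn_starQuot hf) hPa fun x hx => ?_
    filter_upwards [classA_eventually_ne_zero hf hx,
      mem_nhdsWithin_of_mem_nhds (isOpen_unitDisc.mem_nhds hx)] with z h1 h2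
    rw [starQuot, div_eq_iff h1, mul_comm (P z)]
    exact hmul h2
  exact ⟨hf, hPa.congr isOpen_unitDisc heq.symm, hQ, W, hWa, hW0,
    fun z hz => norm_lt_one_of_norm_ne_one hW.continuousOn hW0 hW1 hz,
    fun z hz => (heq hz).trans (hPW z hz)⟩

/-! ### The three differential subordinations. -/

theorem mem_starlikeB_of_mul {f : ℂ → ℂ} (hf : f ∈ classA) {β : ℝ}
    (h : Subordinate (removeSing fun z => 1 + (β : ℂ) * starQuot f z * frakM f z) phiC)
    (hβ : 1 / (1 - Real.exp (Real.exp (-1) - 1)) ≤ β) : f ∈ starlikeB := by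
  obtain ⟨P₀, hP₀a, hP₀0, hP₀f, hP₀⟩ := exists_starQuot_extension hf
  have hq : Real.exp (Real.exp (-1) - 1) < 1 :=
    Real.exp_lt_one_iff.2 (by linarith [exp_neg_one_bounds.2])
  obtain ⟨g, hgd, hgR, hgω⟩ := exists_limacon_valued_primitive
    (T := fun z => 1 + (β : ℂ) * starQuot f z * frakM f z) (R := fun z => P₀ z - 1)
    (fun x hx => (MeromorphicAt.const 1 x).add (((MeromorphicAt.const _ x).mul
      (meromorphicOn_starQuot hf x hx)).mul (meromorphicOn_frakM hf x hx))) h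
    (sub_pos.2 hq) hβ (hP₀a.sub analyticAt_const) (by simp [hP₀0]) (by
      filter_upwards [hP₀] with z hz
      obtain ⟨h1, h2, h3⟩ := hz
      rw [deriv_sub_const, h1, h3]
      field_simp)
  set b := 1 - Real.exp (Real.exp (-1) - 1) with hb
  have hre : ∀ z ∈ unitDisc, Real.exp (Real.exp (-1) - 1) ≤ (1 + g z).re := by
    intro z hz
    obtain ⟨ω, hω, h1⟩ := hgω z hz
    rw [h1, Complex.add_re, Complex.re_ofReal_mul, Complex.one_re]
    nlinarith [limacon_re_ge hω]
  have hslit : ∀ z ∈ unitDisc, 1 + g z ∈ Complex.slitPlane := fun z hz =>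
    Or.inl ((Real.exp_pos _).trans_le (hre z hz))
  -- The limaçon gives Re(1 + g) ≥ exp(1/e - 1), hence Re log(1 + g) ≥ 1/e - 1 and the second
  -- logarithm is also defined.
  have hslit2 : ∀ z ∈ unitDisc, 1 + Complex.log (1 + g z) ∈ Complex.slitPlane := by
    intro z hz
    left
    have h1 := Real.log_le_log (Real.exp_pos _) ((hre z hz).trans (Complex.re_le_norm _))
    rw [Real.log_exp] at h1
    rw [Complex.add_re, Complex.log_re, Complex.one_re]
    linarith [Real.exp_pos (-1)]
  have hWQ : ∀ z ∈ unitDisc, 1 + g z = bellQ (Complex.log (1 + Complex.log (1 + g z))) := by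
    intro z hz
    rw [bellQ, Complex.exp_log (Complex.slitPlane_ne_zero (hslit2 z hz)), add_sub_cancel_left,
      Complex.exp_log (Complex.slitPlane_ne_zero (hslit z hz))]
  refine mem_starlikeB_of_eq (P := fun z => 1 + g z)
    (W := fun z => Complex.log (1 + Complex.log (1 + g z))) hf hP₀f ?_ ?_ ?_ ?_ hWQ
  · filter_upwards [hgR] with z hz
    rw [hz]; ring
  · exact (((hgd.const_add 1).clog hslit).const_add 1).clog hslit2
  · rw [hgR.self_of_nhds]; simp [hP₀0]
  · intro z hz hn
    obtain ⟨ω, hω, h1⟩ := hgω z hz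
    apply exp_exp_sub_one_ne_of_norm_eq_one hn hω
    rw [← h1]
    exact (hWQ z hz).symm

theorem mem_starlikeB_of_frakM {f : ℂ → ℂ} (hf : f ∈ classA) {β : ℝ}
    (h : Subordinate (removeSing fun z => 1 + (β : ℂ) * frakM f z) phiC)
    (hβ : Real.exp 1 / (Real.exp 1 - 1) ≤ β) : f ∈ starlikeB := by
  obtain ⟨P₀, hP₀a, hP₀0, hP₀f, hP₀⟩ := exists_starQuot_extension hf
  have hb : 1 / (1 - Real.exp (-1)) = Real.exp 1 / (Real.exp 1 - 1) := by
    have h1 : Real.exp 1 * Real.exp (-1) = 1 := by rw [← Real.exp_add]; simp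
    rw [div_eq_div_iff (by linarith [exp_neg_one_bounds.2]) (by linarith [Real.exp_one_gt_d9])]
    linarith
  rw [← hb] at hβ
  have hslit₀ : P₀ 0 ∈ Complex.slitPlane := by rw [hP₀0]; exact Complex.one_mem_slitPlane
  obtain ⟨g, hgd, hgR, hgω⟩ := exists_limacon_valued_primitive
    (T := fun z => 1 + (β : ℂ) * frakM f z) (R := fun z => Complex.log (P₀ z))
    (fun x hx => (MeromorphicAt.const 1 x).add ((MeromorphicAt.const _ x).mul
      (meromorphicOn_frakM hf x hx))) h
    (by linarith [exp_neg_one_bounds.2]) hβ (hP₀a.clog hslit₀) (by simp [hP₀0]) (by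
      filter_upwards [hP₀, hP₀a.eventually_analyticAt.filter_mono nhdsWithin_le_nhds,
        (hP₀a.continuousAt.eventually_mem (Complex.isOpen_slitPlane.mem_nhds hslit₀)).filter_mono
          nhdsWithin_le_nhds] with z h1 h2 h3
      rw [(h2.differentiableAt.hasDerivAt.clog h3).deriv, h1.2.2]
      ring)
  have hre : ∀ z ∈ unitDisc, Real.exp (-1) ≤ (1 + g z).re := by
    intro z hz
    obtain ⟨ω, hω, h1⟩ := hgω z hz
    rw [h1, Complex.add_re, Complex.re_ofReal_mul, Complex.one_re]
    nlinarith [limacon_re_ge hω, exp_neg_one_bounds.2]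
  have hslit : ∀ z ∈ unitDisc, 1 + g z ∈ Complex.slitPlane := fun z hz =>
    Or.inl ((Real.exp_pos _).trans_le (hre z hz))
  have hWexp : ∀ z ∈ unitDisc, Complex.exp (Complex.log (1 + g z)) = 1 + g z := fun z hz =>
    Complex.exp_log (Complex.slitPlane_ne_zero (hslit z hz))
  refine mem_starlikeB_of_eq (P := fun z => Complex.exp (g z))
    (W := fun z => Complex.log (1 + g z)) hf hP₀f ?_ ?_ ?_ ?_ ?_
  · filter_upwards [hgR,
      hP₀a.continuousAt.eventually_mem (Complex.isOpen_slitPlane.mem_nhds hslit₀)] with z hz hs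
    rw [hz, Complex.exp_log (Complex.slitPlane_ne_zero hs)]
  · exact (hgd.const_add 1).clog hslit
  · rw [hgR.self_of_nhds]; simp [hP₀0]
  · intro z hz hn
    obtain ⟨ω, hω, h1⟩ := hgω z hz
    apply exp_ne_of_norm_eq_one hn hω
    rw [← h1]
    exact hWexp z hz
  · intro z hz
    rw [bellQ, hWexp z hz, add_sub_cancel_left]

theorem mem_starlikeB_of_div {f : ℂ → ℂ} (hf : f ∈ classA) {β : ℝ}
    (h : Subordinate (removeSing fun z => 1 + (β : ℂ) * (starQuot f z)⁻¹ * frakM f z) phiC)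
    (hβ : 5 * Real.exp (Real.exp 1 - 1) / (3 * (Real.exp (Real.exp 1 - 1) - 1)) ≤ β) :
    f ∈ starlikeB := by
  obtain ⟨P₀, hP₀a, hP₀0, hP₀f, hP₀⟩ := exists_starQuot_extension hf
  have he := Real.exp_one_gt_d9
  have hX : Real.exp (1 - Real.exp 1) < 1 := Real.exp_lt_one_iff.2 (by linarith)
  have hX' : 1 < Real.exp (Real.exp 1 - 1) := Real.one_lt_exp_iff.2 (by linarith)
  have hb : 1 / (3 / 5 * (1 - Real.exp (1 - Real.exp 1))) =
      5 * Real.exp (Real.exp 1 - 1) / (3 * (Real.exp (Real.exp 1 - 1) - 1)) := by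
    have h1 : Real.exp (Real.exp 1 - 1) * Real.exp (1 - Real.exp 1) = 1 := by
      rw [← Real.exp_add]; simp
    rw [div_eq_div_iff (by linarith) (by linarith)]
    linarith
  rw [← hb] at hβ
  have hP₀ne : P₀ 0 ≠ 0 := by rw [hP₀0]; exact one_ne_zero
  obtain ⟨g, hgd, hgR, hgω⟩ := exists_limacon_valued_primitive
    (T := fun z => 1 + (β : ℂ) * (starQuot f z)⁻¹ * frakM f z) (R := fun z => 1 - (P₀ z)⁻¹)
    (fun x hx => (MeromorphicAt.const 1 x).add (((MeromorphicAt.const _ x).mul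
      (meromorphicOn_starQuot hf x hx).inv).mul (meromorphicOn_frakM hf x hx))) h
    (by linarith) hβ (analyticAt_const.sub (hP₀a.inv hP₀ne)) (by simp [hP₀0]) (by
      filter_upwards [hP₀, hP₀a.eventually_analyticAt.filter_mono nhdsWithin_le_nhds]
        with z h1 h2
      rw [((h2.differentiableAt.hasDerivAt.fun_inv h1.2.1).const_sub 1).deriv, h1.1, h1.2.2]
      have := h1.2.1
      field_simp)
  have hnorm : ∀ z ∈ unitDisc, ‖g z‖ < 1 := by
    intro z hz
    obtain ⟨ω, hω, h1⟩ := hgω z hz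
    rw [h1, norm_mul, Complex.norm_real, Real.norm_of_nonneg (by linarith)]
    nlinarith [limacon_norm_lt hω, Real.exp_pos (1 - Real.exp 1)]
  have hslit : ∀ z ∈ unitDisc, 1 - g z ∈ Complex.slitPlane := by
    intro z hz
    left
    rw [Complex.sub_re, Complex.one_re]
    linarith [Complex.re_le_norm (g z), hnorm z hz]
  have hslit2 : ∀ z ∈ unitDisc, 1 - Complex.log (1 - g z) ∈ Complex.slitPlane := by
    intro z hz
    left
    have h1 : ‖1 - g z‖ < 2 := by
      refine (norm_sub_le _ _).trans_lt ?_
      rw [norm_one]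
      linarith [hnorm z hz]
    -- Since |1 - g| < 2, log|1 - g| ≤ |1 - g| - 1 < 1, which keeps the argument of the outer
    -- logarithm in the right half-plane.
    have h2 := Real.log_le_sub_one_of_pos
      (norm_pos_iff.2 (Complex.slitPlane_ne_zero (hslit z hz)))
    rw [Complex.sub_re, Complex.log_re, Complex.one_re]
    linarith
  have hWexp : ∀ z ∈ unitDisc,
      Complex.exp (Complex.log (1 - Complex.log (1 - g z))) = 1 - Complex.log (1 - g z) :=
    fun z hz => Complex.exp_log (Complex.slitPlane_ne_zero (hslit2 z hz))
  refine mem_starlikeB_of_eq (P := fun z => (1 - g z)⁻¹)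
    (W := fun z => Complex.log (1 - Complex.log (1 - g z))) hf hP₀f ?_ ?_ ?_ ?_ ?_
  · filter_upwards [hgR] with z hz
    rw [hz]; simp
  · exact (((hgd.const_sub 1).clog hslit).const_sub 1).clog hslit2
  · rw [hgR.self_of_nhds]; simp [hP₀0]
  · intro z hz hn
    obtain ⟨ω, hω, h1⟩ := hgω z hz
    apply exp_one_sub_exp_ne_of_norm_eq_one hn hω
    rw [← h1, hWexp z hz, sub_sub_cancel,
      Complex.exp_log (Complex.slitPlane_ne_zero (hslit z hz))]
  · intro z hz
    rw [bellQ, hWexp z hz, sub_sub_cancel_left, Complex.exp_neg,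
      Complex.exp_log (Complex.slitPlane_ne_zero (hslit z hz))]

theorem corollary2p11 (f : ℂ → ℂ) (hf : f ∈ classA) (β : ℝ)
    (h :
      (Subordinate (removeSing fun z => 1 + (β : ℂ) * starQuot f z * frakM f z) phiC ∧
          1 / (1 - Real.exp (Real.exp (-1) - 1)) ≤ β) ∨
      (Subordinate (removeSing fun z => 1 + (β : ℂ) * frakM f z) phiC ∧
          Real.exp 1 / (Real.exp 1 - 1) ≤ β) ∨
      (Subordinate (removeSing fun z => 1 + (β : ℂ) * (starQuot f z)⁻¹ * frakM f z) phiC ∧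
          5 * Real.exp (Real.exp 1 - 1) / (3 * (Real.exp (Real.exp 1 - 1) - 1)) ≤ β)) :
    f ∈ starlikeB := by
  rcases h with ⟨h, hβ⟩ | ⟨h, hβ⟩ | ⟨h, hβ⟩
  · exact mem_starlikeB_of_mul hf h hβ
  · exact mem_starlikeB_of_frakM hf h hβ
  · exact mem_starlikeB_of_div hf h hβ
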